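/- Let $\mathsf C$ be a triangulated category with suspension $\Sigma$. Its abelianisation $\operatorname{Ab}\mathsf C$ is the abelian category of additive functors $F\colon\mathsf C^{\mathrm{op}}\to\mathrm{Ab}$ admitting a copresentation $0\to F\to\operatorname{Hom}(-,A)\to\operatorname{Hom}(-,B)$, and $\mathsf C$ is called locally finite if every object of $\operatorname{Ab}\mathsf C$ has finite length (equivalently, $\operatorname{Ab}\mathsf C$ has Krull–Gabriel dimension at most $0$). A cohomological functor $H\colon\mathsf C^{\mathrm{op}}\to\mathrm{Ab}$ is endofinite if for each object $C$ the $\operatorname{End}(H)$-module $H(C)$ has finite length and $H(\Sigma^nC)=0$ for some $n\in\mathbb Z$; in this case put $\chi_H(C)=\operatorname{length}_{\operatorname{End}(H)}H(C)$. A function $\chi\colon\operatorname{Ob}\mathsf C\to\mathbb N$ is cohomological if (1) $\chi(C\oplus C')=\chi(C)+\chi(C')$ for all $C,C'$; (2) for each $C$ there is $n\in\mathbb Z$ with $\chi(\Sigma^nC)=0$; (3) for each exact triangle $A\to B\to C\to\Sigma A$ and each labelling $(X_i)_{i\in\mathbb Z}$ of the consecutive terms of the induced sequence $\cdots\to\Sigma^{-1}B\to\Sigma^{-1}C\to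 A\to B\to C\to\Sigma A\to\cdots$ with $\chi(X_0)=0$, one has $\sum_{i}(-1)^{i+n}\chi(X_i)\ge0$ for all $n\in\mathbb Z$, where $i$ runs over all integers between $0$ and $n$ (both included, for either sign of $n$), with equality when $\chi(X_n)=0$. A non-zero cohomological function is irreducible if it is not a sum of two non-zero cohomological functions. The points of $\operatorname{Sp}\mathsf C$ are the classes $[\chi]=\{\chi\circ\Sigma^n\mid n\in\mathbb Z\}$ with $\chi$ an irreducible cohomological function. Proposition. Let $\mathsf C$ be a locally finite and idempotent complete triangulated category, and suppose that for each pair of objects $X,Y$ one has $\operatorname{Hom}(X,\Sigma^nY)=0$ for some $n\in\mathbb Z$. Then for every object $X$ the functor $\operatorname{Hom}(-,X)$ is an endofinite cohomological functor and, writing $\chi_X=\chi_{\operatorname{Hom}(-,X)}$, \[\operatorname{Sp}\mathsf C=\{[\chi_X]\mid X\in\mathsf C\text{ indecomposable}\}.\] -/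

import Mathlib

open CategoryTheory CategoryTheory.Limits CategoryTheory.Pretriangulated
open CategoryTheory.Pretriangulated.Opposite

universe v u

noncomputable section

namespace CohFun

section Functors

variable {C : Type u} [Category.{v} C]

/-- The natural left action of the endomorphism ring of a functor `H : Cᵒᵖ ⥤ Ab`
(all natural transformations `H ⟶ H`) on the group `H(X)`. -/
instance endModule (H : Cᵒᵖ ⥤ AddCommGrpCat.{v}) (X : Cᵒᵖ) : Module (End H) (H.obj X) where
  smul φ x := (φ : H ⟶ H).app X x
  one_smul _ := rfl
  mul_smul _ _ _ := rfl
  smul_zero φ := map_zero ((φ : H ⟶ H).app X).hom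
  smul_add φ := map_add ((φ : H ⟶ H).app X).hom
  add_smul _ _ _ := rfl
  zero_smul _ := rfl

/-- The function `χ_H : Ob C → ℕ`, `X ↦ length_{End(H)} H(X)`. It is meaningful when
all these lengths are finite, in particular when `H` is endofinite. -/
def lengthFunction (H : Cᵒᵖ ⥤ AddCommGrpCat.{v}) : C → ℕ :=
  fun X => (Module.length (End H) (H.obj (Opposite.op X))).toNat

variable [Preadditive C]

/-- A functor `F : Cᵒᵖ ⥤ Ab` admitting a copresentation `0 ⟶ F ⟶ Hom(-,A) ⟶ Hom(-,B)`.
(Such an `F` is automatically additive, being a subfunctor of an additive one.) -/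
def isCopresented (C : Type u) [Category.{v} C] [Preadditive C] :
    ObjectProperty (Cᵒᵖ ⥤ AddCommGrpCat.{v}) := fun F =>
  ∃ (A B : C) (f : A ⟶ B) (ι : F ⟶ preadditiveYoneda.obj A)
    (w : ι ≫ preadditiveYoneda.map f = 0),
    Mono ι ∧ (ShortComplex.mk ι (preadditiveYoneda.map f) w).Exact

/-- The abelianisation `Ab C`: the full subcategory of the category of functors `Cᵒᵖ ⥤ Ab`
consisting of those functors which admit a copresentation by representable functors. -/
abbrev Abelianisation (C : Type u) [Category.{v} C] [Preadditive C] :=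
  (isCopresented C).FullSubcategory

/-- `C` is locally finite: its abelianisation is a length category, i.e. every object
of `Ab C` has finite length (its subobjects satisfy both chain conditions). -/
def IsLocallyFinite (C : Type u) [Category.{v} C] [Preadditive C] : Prop :=
  ∀ F : Abelianisation C, IsNoetherianObject F ∧ IsArtinianObject F

end Functors

variable {C : Type u} [Category.{v} C] [Preadditive C] [HasZeroObject C] [HasShift C ℤ]
  [∀ n : ℤ, (shiftFunctor C n).Additive] [Pretriangulated C]

/-- An endofinite cohomological functor `H : Cᵒᵖ ⥤ Ab`. -/
structure IsEndofinite (H : Cᵒᵖ ⥤ AddCommGrpCat.{v}) : Prop where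
  /-- `H` sends exact triangles to exact sequences. -/
  cohomological : H.IsHomological
  /-- `H(X)` has finite length over `End(H)`. -/
  finite_length : ∀ X : C, IsFiniteLength (End H) (H.obj (Opposite.op X))
  /-- For each `X` the group `H(Σⁿ X)` vanishes for some `n`. -/
  vanishing : ∀ X : C, ∃ n : ℤ, IsZero (H.obj (Opposite.op (X⟦n⟧)))

/-- The objects of the sequence
`⋯ → Σ⁻¹B → Σ⁻¹C → A → B → C → ΣA → ΣB → ⋯` induced by a triangle `A → B → C → ΣA`,
numbered so that `A`, `B`, `C` stand in the positions `0`, `1`, `2`. -/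
def triangleSeq (T : Triangle C) (j : ℤ) : C :=
  if j % 3 = 0 then T.obj₁⟦j / 3⟧ else if j % 3 = 1 then T.obj₂⟦j / 3⟧ else T.obj₃⟦j / 3⟧

/-- A cohomological function `χ : Ob C → ℕ`. -/
structure IsCohomologicalFunction (χ : C → ℕ) : Prop where
  /-- `χ(X ⊕ Y) = χ(X) + χ(Y)`, where `X ⊕ Y` is any object that is a biproduct. -/
  biprod : ∀ (X Y : C) (b : BinaryBicone X Y), b.IsBilimit → χ b.pt = χ X + χ Y
  /-- For each `X` we have `χ(Σⁿ X) = 0` for some `n`. -/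
  vanishing : ∀ X : C, ∃ n : ℤ, χ (X⟦n⟧) = 0
  /-- For each exact triangle and each labelling `X i = triangleSeq T (m + i)` of the induced
  sequence with `χ(X 0) = 0`, the alternating sums of the `χ(X i)`, over the indices `i`
  from `0` to `n` (in either direction), with sign `+` at `X n`, are non-negative,
  with equality when `χ(X n) = 0`. -/
  triangle : ∀ T ∈ distTriang C, ∀ m : ℤ, χ (triangleSeq T m) = 0 → ∀ n : ℤ,
    0 ≤ ∑ i ∈ Finset.uIcc 0 n, ((i + n).negOnePow : ℤ) * (χ (triangleSeq T (m + i)) : ℤ) ∧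
    (χ (triangleSeq T (m + n)) = 0 →
      ∑ i ∈ Finset.uIcc 0 n, ((i + n).negOnePow : ℤ) * (χ (triangleSeq T (m + i)) : ℤ) = 0)

/-- A non-zero cohomological function is irreducible if it is not the sum of two non-zero
cohomological functions. -/
structure IsIrreducibleFunction (χ : C → ℕ) : Prop where
  cohomological : IsCohomologicalFunction χ
  ne_zero : χ ≠ 0
  irreducible : ∀ χ₁ χ₂ : C → ℕ, IsCohomologicalFunction χ₁ → IsCohomologicalFunction χ₂ →
    χ = χ₁ + χ₂ → χ₁ = 0 ∨ χ₂ = 0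

/-- The equivalence class `[χ] = {χ ∘ Σⁿ ∣ n ∈ ℤ}`. -/
def shiftClass (χ : C → ℕ) : Set (C → ℕ) :=
  Set.range fun (n : ℤ) => fun (X : C) => χ (X⟦n⟧)

/-- The set of points of the space `Sp C` of cohomological functions on `C`: the orbits
`[χ]` of the irreducible cohomological functions `χ` under the suspension. -/
def Sp (C : Type u) [Category.{v} C] [Preadditive C] [HasZeroObject C] [HasShift C ℤ]
    [∀ n : ℤ, (shiftFunctor C n).Additive] [Pretriangulated C] : Set (Set (C → ℕ)) :=
  {P | ∃ χ : C → ℕ, IsIrreducibleFunction χ ∧ P = shiftClass χ}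

/-- `χ_X = χ_{Hom(-,X)}`. -/
def chi (X : C) : C → ℕ := lengthFunction (preadditiveYoneda.obj X)

end CohFun

end

set_option linter.unusedSectionVars false

namespace CohFun

open scoped ZeroObject

/-! ### Copresented functors: representables and kernels. -/

section Preadditive

variable {C : Type u} [Category.{v} C] [Preadditive C]

/-! A cohomological function `χ` should be thought of as an additive function on the length category
Ab C. Its value on the image of Hom(-,f) is `rank χ f`, and additivity on short exact sequences
takes the form of `exists_rank_eq_add`, which rests on the octahedral axiom. For `χ_X` the rank is
the length of the image of Hom(f,X) (`IsEndofinite.rank_eq`). Finite length in Ab C is used only as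
chain conditions on morphisms ordered by factorization: kernels of Hom(-,f) are subobjects of
Hom(-,A), and representables are injective (`exists_factor_of_kernel_le`).

For X indecomposable, a Fitting argument shows that `e` or `1 - e` is invertible for every
endomorphism `e`, so the injective object Hom(-,X) has a simple essential socle, the image of some
`s : W ⟶ X` (`exists_isSocle`). A non-zero `χ` is non-zero on some simple object, and this object is
the socle of Hom(-,X) for some indecomposable X (`exists_isSocle_rank_ne_zero`).

If `rank χ s ≠ 0`, then `χ_X` is dominated by `χ` on all morphisms (`imageLength_le_rank`), so `χ -
χ_X` is cohomological and an irreducible `χ` equals `χ_X`. Conversely, `χ_X` has rank 1 on `s`, so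
in a decomposition of `χ_X` one summand has rank 0 on `s`. That summand vanishes, because `s`
represents the only simple object on which `χ_X` is non-zero (`eq_zero_of_rank_socle_eq_zero`). -/

lemma isCopresented_kernel {A B : C} (f : A ⟶ B) :
    isCopresented C (kernel (preadditiveYoneda.map f)) :=
  ⟨A, B, f, kernel.ι _, kernel.condition _, inferInstance,
    ShortComplex.exact_of_f_is_kernel _ (kernelIsKernel _)⟩

lemma isCopresented_yoneda (A : C) : isCopresented C (preadditiveYoneda.obj A) :=
  ⟨A, A, 0, 𝟙 _, by simp, inferInstance,
    (ShortComplex.exact_iff_epi _ (by simp)).2 (by dsimp; infer_instance)⟩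

/-- The representable functor `Hom(-,A)` as an object of the abelianisation. -/
abbrev yonedaAb (A : C) : Abelianisation C := ⟨_, isCopresented_yoneda A⟩

/-- The kernel of `Hom(-,f)` as an object of the abelianisation. -/
noncomputable abbrev kernelAb {A B : C} (f : A ⟶ B) : Abelianisation C :=
  ⟨_, isCopresented_kernel f⟩

/-- The inclusion of the kernel of `Hom(-,f)`. -/
noncomputable abbrev kernelAbι {A B : C} (f : A ⟶ B) : kernelAb f ⟶ yonedaAb A :=
  ObjectProperty.homMk (kernel.ι (preadditiveYoneda.map f))

instance {A B : C} (f : A ⟶ B) : Mono (kernelAbι f) :=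
  (isCopresented C).ι.mono_of_mono_map (by dsimp; infer_instance)

end Preadditive

/-! ### Weak kernels and chain conditions for morphisms. -/

section Pretriangulated

variable {C : Type u} [Category.{v} C] [Preadditive C] [HasZeroObject C] [HasShift C ℤ]
  [∀ n : ℤ, (shiftFunctor C n).Additive] [Pretriangulated C]

/-- A weak kernel of a morphism. -/
lemma exists_weakKernel {A B : C} (f : A ⟶ B) :
    ∃ (W : C) (w : W ⟶ A), w ≫ f = 0 ∧
      (∀ (V : C) (g : V ⟶ A), g ≫ f = 0 → ∃ t, g = t ≫ w) ∧
      (∀ (Z : C) (g : A ⟶ Z), w ≫ g = 0 → ∃ t, g = f ≫ t) := by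
  obtain ⟨W, w, d, hT⟩ := distinguished_cocone_triangle₁ f
  exact ⟨W, w, comp_distTriang_mor_zero₁₂ _ hT, fun V g hg => Triangle.coyoneda_exact₂ _ hT g hg,
    fun Z g hg => Triangle.yoneda_exact₂ _ hT g hg⟩

/-- A weak cokernel of a morphism. -/
lemma exists_weakCokernel {A B : C} (f : A ⟶ B) :
    ∃ (Z : C) (p : B ⟶ Z), f ≫ p = 0 ∧
      (∀ (V : C) (g : V ⟶ B), g ≫ p = 0 → ∃ t, g = t ≫ f) ∧
      (∀ (Y : C) (g : B ⟶ Y), f ≫ g = 0 → ∃ t, g = p ≫ t) := by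
  obtain ⟨W, w, d, hT⟩ := distinguished_cocone_triangle f
  exact ⟨W, w, comp_distTriang_mor_zero₁₂ _ hT, fun V g hg => Triangle.coyoneda_exact₂ _ hT g hg,
    fun Z g hg => Triangle.yoneda_exact₂ _ hT g hg⟩

/-- This is the injectivity of Hom(-,D) in Ab C. It suffices to test the hypothesis on a weak kernel
of `f`, since in a triangle whatever kills the first map factors through the second. -/
lemma exists_factor_of_kernel_le {A B D : C} (f : A ⟶ B) (h : A ⟶ D)
    (H : ∀ (V : C) (a : V ⟶ A), a ≫ f = 0 → a ≫ h = 0) : ∃ t, h = f ≫ t := by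
  obtain ⟨W, w, hw, -, h₂⟩ := exists_weakKernel f
  exact h₂ _ h (H _ w hw)

/-- The kernel of `Hom(-,f)` as a subobject of `Hom(-,A)`. -/
noncomputable def kernelAbSubobject {A B : C} (f : A ⟶ B) : Subobject (yonedaAb A) :=
  Subobject.mk (kernelAbι f)

lemma kernelAbSubobject_le_iff {A B D : C} (f : A ⟶ B) (g : A ⟶ D) :
    kernelAbSubobject g ≤ kernelAbSubobject f ↔ ∃ t, f = g ≫ t := by
  constructor
  · intro h
    apply exists_factor_of_kernel_le
    intro V a ha
    have h' : (kernel.ι (preadditiveYoneda.map g)) ≫ preadditiveYoneda.map f = 0 := by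
      have h₁ := congr_arg (fun x => x.hom) (Subobject.ofMkLEMk_comp (h : Subobject.mk _ ≤ Subobject.mk _))
      dsimp at h₁
      rw [← h₁, Category.assoc, kernel.condition, comp_zero]
    apply preadditiveYoneda.map_injective
    rw [Functor.map_comp, Functor.map_zero, ← kernel.lift_ι (preadditiveYoneda.map g)
      (preadditiveYoneda.map a) (by rw [← Functor.map_comp, ha, Functor.map_zero]),
      Category.assoc, h', comp_zero]
  · rintro ⟨t, rfl⟩
    refine Subobject.mk_le_mk_of_comm (ObjectProperty.homMk (kernel.lift _ (kernel.ι _) ?_)) ?_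
    · rw [Functor.map_comp, kernel.condition_assoc, zero_comp]
    · ext : 1
      exact kernel.lift_ι _ _ _

/-- Descending chain condition for morphisms out of `A`, ordered by factorization. -/
lemma exists_minimal_under (hfin : IsLocallyFinite C) (A : C) (P : ∀ Z : C, (A ⟶ Z) → Prop) (hP : ∃ Z f, P Z f) :
    ∃ (Z : C) (f : A ⟶ Z), P Z f ∧
      ∀ (Y : C) (g : A ⟶ Y), P Y g → (∃ t, g = f ≫ t) → ∃ t, f = g ≫ t := by
  have := (hfin (yonedaAb A)).1
  obtain ⟨Z, f, hf⟩ := hP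
  obtain ⟨_, ⟨Z, f, hf, rfl⟩, h⟩ := (wellFounded_gt (α := Subobject (yonedaAb A))).has_min
    {S | ∃ Z f, P Z f ∧ S = kernelAbSubobject f} ⟨_, Z, f, hf, rfl⟩
  refine ⟨Z, f, hf, fun Y g hg hfg => ?_⟩
  rw [← kernelAbSubobject_le_iff] at hfg ⊢
  have := h _ ⟨Y, g, hg, rfl⟩
  by_contra h'
  exact this (lt_of_le_not_ge hfg h')

/-- Ascending chain condition for morphisms out of `A`, ordered by factorization. -/
lemma exists_maximal_under (hfin : IsLocallyFinite C) (A : C) (P : ∀ Z : C, (A ⟶ Z) → Prop) (hP : ∃ Z f, P Z f) :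
    ∃ (Z : C) (f : A ⟶ Z), P Z f ∧
      ∀ (Y : C) (g : A ⟶ Y), P Y g → (∃ t, f = g ≫ t) → ∃ t, g = f ≫ t := by
  have := (hfin (yonedaAb A)).2
  obtain ⟨Z, f, hf⟩ := hP
  obtain ⟨_, ⟨Z, f, hf, rfl⟩, h⟩ := (wellFounded_lt (α := Subobject (yonedaAb A))).has_min
    {S | ∃ Z f, P Z f ∧ S = kernelAbSubobject f} ⟨_, Z, f, hf, rfl⟩
  refine ⟨Z, f, hf, fun Y g hg hfg => ?_⟩
  rw [← kernelAbSubobject_le_iff] at hfg ⊢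
  have := h _ ⟨Y, g, hg, rfl⟩
  by_contra h'
  exact this (lt_of_le_not_ge hfg h')

/-- Descending chain condition for morphisms into `A`, ordered by factorization. -/
lemma exists_minimal_over (hfin : IsLocallyFinite C) (A : C) (P : ∀ Z : C, (Z ⟶ A) → Prop) (hP : ∃ Z f, P Z f) :
    ∃ (Z : C) (f : Z ⟶ A), P Z f ∧
      ∀ (Y : C) (g : Y ⟶ A), P Y g → (∃ t, g = t ≫ f) → ∃ t, f = t ≫ g := by
  -- The image of Hom(-,f) is the kernel of Hom(-,p) for `p` a weak cokernel of `f`. Passing to weak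
  -- cokernels therefore reverses the order and reduces the claim to morphisms out of `A`.
  let Q : ∀ Z : C, (A ⟶ Z) → Prop := fun Z p => ∃ (W : C) (f : W ⟶ A), P W f ∧ f ≫ p = 0 ∧
      (∀ (V : C) (g : V ⟶ A), g ≫ p = 0 → ∃ t, g = t ≫ f)
  have hQ : ∃ Z p, Q Z p := by
    obtain ⟨W, f, hf⟩ := hP
    obtain ⟨Z, p, h₁, h₂, h₃⟩ := exists_weakCokernel f
    exact ⟨Z, p, W, f, hf, h₁, h₂⟩
  obtain ⟨Z, p, ⟨W, f, hf, h₁, h₂⟩, hp⟩ := exists_maximal_under hfin A Q hQ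
  refine ⟨W, f, hf, ?_⟩
  rintro Y g hg ⟨t, rfl⟩
  obtain ⟨Z', p', h₁', h₂', h₃'⟩ := exists_weakCokernel (t ≫ f)
  obtain ⟨s, rfl⟩ := hp Z' p' ⟨Y, _, hg, h₁', h₂'⟩ (h₃' _ p (by rw [Category.assoc, h₁, comp_zero]))
  exact h₂' _ _ (by rw [reassoc_of% h₁, zero_comp])

end Pretriangulated

section LinearMaps

variable {C : Type u} [Category.{v} C]

/-- The action of a morphism on a functor `H`, as a map of `End(H)`-modules. -/
def mapLinear (H : Cᵒᵖ ⥤ AddCommGrpCat.{v}) {A B : C} (f : A ⟶ B) :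
    H.obj (Opposite.op B) →ₗ[End H] H.obj (Opposite.op A) where
  toFun := (H.map f.op).hom
  map_add' := map_add _
  map_smul' φ x := (ConcreteCategory.congr_hom ((φ : H ⟶ H).naturality f.op) x).symm

lemma mapLinear_comp (H : Cᵒᵖ ⥤ AddCommGrpCat.{v}) {A B D : C} (f : A ⟶ B) (g : B ⟶ D) :
    mapLinear H (f ≫ g) = mapLinear H f ∘ₗ mapLinear H g := by
  ext x
  exact ConcreteCategory.congr_hom (H.map_comp g.op f.op) x

lemma mapLinear_id (H : Cᵒᵖ ⥤ AddCommGrpCat.{v}) (A : C) :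
    mapLinear H (𝟙 A) = LinearMap.id := by
  ext x
  exact ConcreteCategory.congr_hom (H.map_id (Opposite.op A)) x

variable [Preadditive C]

/-- The `End(X)`-submodule of `Hom(A,X)` of all morphisms factoring through `g : A ⟶ Z`. -/
def factoring (X : C) {A Z : C} (g : A ⟶ Z) :
    Submodule (End (preadditiveYoneda.obj X)) ((preadditiveYoneda.obj X).obj (Opposite.op A)) :=
  LinearMap.range (mapLinear (preadditiveYoneda.obj X) g)

lemma mem_factoring {X A Z : C} (g : A ⟶ Z) (u : A ⟶ X) :
    (show (preadditiveYoneda.obj X).obj (Opposite.op A) from u) ∈ factoring X g ↔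
      ∃ t, u = g ≫ t :=
  ⟨fun ⟨t, ht⟩ => ⟨t, ht.symm⟩, fun ⟨t, ht⟩ => ⟨t, ht.symm⟩⟩

end LinearMaps

/-! ### Representable functors are endofinite. -/

section Pretriangulated

variable {C : Type u} [Category.{v} C] [Preadditive C] [HasZeroObject C] [HasShift C ℤ]
  [∀ n : ℤ, (shiftFunctor C n).Additive] [Pretriangulated C]

/-- Every `End(X)`-submodule of `Hom(A,X)` consists of the morphisms factoring through
some `g`, and this `g` may be chosen to be universal. -/
lemma exists_factoring_eq (hfin : IsLocallyFinite C) (X A : C)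
    (U : Submodule (End (preadditiveYoneda.obj X))
      ((preadditiveYoneda.obj X).obj (Opposite.op A))) :
    ∃ (Z : C) (g : A ⟶ Z), factoring X g = U ∧
      ∀ (Y : C) (g' : A ⟶ Y), factoring X g ≤ factoring X g' → ∃ t, g = g' ≫ t := by
  -- Start from the zero map and enlarge `g` to `(g, u) : A ⟶ Z ⊞ X` for `u` in `U`. This preserves
  -- both conditions, so a maximal `g` already accounts for every `u`. Universality turns inclusions
  -- of submodules into factorizations, to which the chain conditions apply.
  obtain ⟨Z, g, ⟨hg, hg'⟩, hmax⟩ := exists_maximal_under hfin A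
    (fun Z g => factoring X g ≤ U ∧
      ∀ (Y : C) (g' : A ⟶ Y), factoring X g ≤ factoring X g' → ∃ t, g = g' ≫ t)
    ⟨X, 0, by
      rintro _ ⟨t, rfl⟩
      have : mapLinear (preadditiveYoneda.obj X) (0 : A ⟶ X) t = 0 :=
        (zero_comp : (0 : A ⟶ X) ≫ (show X ⟶ X from t) = 0)
      rw [this]
      exact U.zero_mem, fun Y g' _ => ⟨0, by simp⟩⟩
  refine ⟨Z, g, le_antisymm hg ?_, hg'⟩
  intro (u : A ⟶ X) hu
  have hle : ∀ t : Z ⊞ X ⟶ X, biprod.lift g u ≫ t = g ≫ biprod.inl ≫ t + u ≫ biprod.inr ≫ t := by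
    intro t
    rw [biprod.lift_eq, Preadditive.add_comp, Category.assoc, Category.assoc]
  have h₁ : factoring X (biprod.lift g u) ≤ U := by
    rintro _ ⟨(t : Z ⊞ X ⟶ X), rfl⟩
    refine (congr_arg (· ∈ U) (hle t)).mpr (U.add_mem (hg ⟨_, rfl⟩) ?_)
    exact U.smul_mem (preadditiveYoneda.map (biprod.inr ≫ t)) hu
  have h₂ : ∀ (Y : C) (g' : A ⟶ Y), factoring X (biprod.lift g u) ≤ factoring X g' →
      ∃ t, biprod.lift g u = g' ≫ t := by
    intro Y g' h
    obtain ⟨s, hs⟩ := hg' Y g' (le_trans (by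
      rintro _ ⟨(t : Z ⟶ X), rfl⟩
      exact (mem_factoring _ _).2 ⟨biprod.fst ≫ t, by rw [biprod.lift_fst_assoc]; rfl⟩) h)
    obtain ⟨r, hr⟩ := (mem_factoring _ _).1 (h ((mem_factoring (biprod.lift g u) u).2
      ⟨biprod.snd, by simp⟩))
    exact ⟨biprod.lift s r, by ext <;> simp [hs, hr]⟩
  obtain ⟨t, ht⟩ := hmax _ (biprod.lift g u) ⟨h₁, h₂⟩ ⟨biprod.fst, by simp⟩
  exact (mem_factoring g u).2 ⟨t ≫ biprod.snd, by rw [← Category.assoc, ← ht, biprod.lift_snd]⟩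

lemma isNoetherian_yoneda (hfin : IsLocallyFinite C) (X A : C) :
    IsNoetherian (End (preadditiveYoneda.obj X))
      ((preadditiveYoneda.obj X).obj (Opposite.op A)) := by
  rw [isNoetherian_iff', WellFoundedGT, isWellFounded_iff, WellFounded.wellFounded_iff_has_min]
  rintro S ⟨U, hU⟩
  obtain ⟨Z₀, g₀, h₀, h₀'⟩ := exists_factoring_eq hfin X A U
  obtain ⟨Z, g, ⟨h₁, h₂⟩, h₃⟩ := exists_maximal_under hfin A
    (fun Z g => factoring X g ∈ S ∧
      ∀ (Y : C) (g' : A ⟶ Y), factoring X g ≤ factoring X g' → ∃ t, g = g' ≫ t)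
    ⟨Z₀, g₀, h₀ ▸ hU, h₀'⟩
  refine ⟨_, h₁, fun V hV hlt => ?_⟩
  obtain ⟨Z', g', rfl, h'⟩ := exists_factoring_eq hfin X A V
  obtain ⟨t, rfl⟩ := h₃ Z' g' ⟨hV, h'⟩ (h₂ _ _ hlt.le)
  refine hlt.not_ge ?_
  rintro _ ⟨(s : Z' ⟶ X), rfl⟩
  exact (mem_factoring _ _).2 ⟨t ≫ s, Category.assoc _ _ _⟩

lemma isArtinian_yoneda (hfin : IsLocallyFinite C) (X A : C) :
    IsArtinian (End (preadditiveYoneda.obj X))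
      ((preadditiveYoneda.obj X).obj (Opposite.op A)) := by
  rw [IsArtinian, WellFoundedLT, isWellFounded_iff, WellFounded.wellFounded_iff_has_min]
  rintro S ⟨U, hU⟩
  obtain ⟨Z₀, g₀, h₀, h₀'⟩ := exists_factoring_eq hfin X A U
  obtain ⟨Z, g, ⟨h₁, h₂⟩, h₃⟩ := exists_minimal_under hfin A
    (fun Z g => factoring X g ∈ S ∧
      ∀ (Y : C) (g' : A ⟶ Y), factoring X g ≤ factoring X g' → ∃ t, g = g' ≫ t)
    ⟨Z₀, g₀, h₀ ▸ hU, h₀'⟩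
  refine ⟨_, h₁, fun V hV hlt => ?_⟩
  obtain ⟨Z', g', rfl, h'⟩ := exists_factoring_eq hfin X A V
  obtain ⟨t, rfl⟩ := h₃ Z' g' ⟨hV, h'⟩ (h' _ _ hlt.le)
  refine hlt.not_ge ?_
  rintro _ ⟨(s : Z ⟶ X), rfl⟩
  exact (mem_factoring _ _).2 ⟨t ≫ s, Category.assoc _ _ _⟩

lemma exists_shift_hom_eq_zero (hvan : ∀ X Y : C, ∃ n : ℤ, ∀ f : X ⟶ Y⟦n⟧, f = 0) (X Y : C) :
    ∃ n : ℤ, ∀ f : X⟦n⟧ ⟶ Y, f = 0 := by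
  obtain ⟨n, hn⟩ := hvan X Y
  refine ⟨-n, fun f => ?_⟩
  apply (shiftFunctor C n).map_injective
  rw [Functor.map_zero, ← cancel_epi ((shiftFunctorCompIsoId C (-n) n (by simp)).inv.app X),
    comp_zero]
  exact hn _

lemma isEndofinite_yoneda (hfin : IsLocallyFinite C)
    (hvan : ∀ X Y : C, ∃ n : ℤ, ∀ f : X ⟶ Y⟦n⟧, f = 0) (X : C) :
    IsEndofinite (preadditiveYoneda.obj X) where
  cohomological := inferInstance
  finite_length A :=
    isFiniteLength_iff_isNoetherian_isArtinian.2
      ⟨isNoetherian_yoneda hfin X A, isArtinian_yoneda hfin X A⟩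
  vanishing A := by
    obtain ⟨n, hn⟩ := exists_shift_hom_eq_zero hvan A X
    exact ⟨n, @AddCommGrpCat.isZero_of_subsingleton _ ⟨fun f g => (hn f).trans (hn g).symm⟩⟩

end Pretriangulated

/-! ### Non-negative alternating sums versus ranks in a sequence. -/

section AlternatingSums

/-- The alternating sum of the values of `x` over the indices between `m` and `m + n`. -/
def altSum (x : ℤ → ℕ) (m n : ℤ) : ℤ :=
  ∑ i ∈ Finset.uIcc 0 n, ((i + n).negOnePow : ℤ) * (x (m + i) : ℤ)

lemma altSum_zero (x : ℤ → ℕ) (m : ℤ) : altSum x m 0 = x m := by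
  simp [altSum]

lemma altSum_aux (x : ℤ → ℕ) (m n n' : ℤ) (h : n' ∉ Finset.uIcc 0 n)
    (h' : Finset.uIcc 0 n' = insert n' (Finset.uIcc 0 n)) (hn : n' = n + 1 ∨ n = n' + 1) :
    altSum x m n + altSum x m n' = x (m + n') := by
  unfold altSum
  rw [h', Finset.sum_insert h, ← two_mul, Int.negOnePow_two_mul]
  have : ∀ i, ((i + n').negOnePow : ℤ) = - ((i + n).negOnePow : ℤ) := by
    intro i
    rcases hn with rfl | rfl
    · rw [← add_assoc, Int.negOnePow_succ]; simp
    · rw [← add_assoc, Int.negOnePow_succ]; simp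
  simp only [this, neg_mul, Finset.sum_neg_distrib, Units.val_one, one_mul]
  ring

lemma altSum_succ (x : ℤ → ℕ) (m n : ℤ) (hn : 0 ≤ n) :
    altSum x m n + altSum x m (n + 1) = x (m + (n + 1)) := by
  refine altSum_aux x m n (n + 1) ?_ ?_ (Or.inl rfl)
  · simp only [Finset.uIcc_of_le hn, Finset.mem_Icc]; omega
  · ext i
    rw [Finset.uIcc_of_le hn, Finset.uIcc_of_le (by omega)]
    simp only [Finset.mem_Icc, Finset.mem_insert]; omega

lemma altSum_pred (x : ℤ → ℕ) (m n : ℤ) (hn : n ≤ 0) :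
    altSum x m n + altSum x m (n - 1) = x (m + (n - 1)) := by
  refine altSum_aux x m n (n - 1) ?_ ?_ (Or.inr (by ring))
  · simp only [Finset.uIcc_of_ge hn, Finset.mem_Icc]; omega
  · ext i
    rw [Finset.uIcc_of_ge hn, Finset.uIcc_of_ge (by omega)]
    simp only [Finset.mem_Icc, Finset.mem_insert]; omega

/-- In a long exact sequence with lengths `x j`, the number `r j` is the rank of the map ending in
position `j`. Starting from a zero term, these ranks are forced to be the alternating sums;
`altSum_of_eq_add` is the converse. -/
lemma exists_of_altSum_nonneg (x : ℤ → ℕ) (m : ℤ) (hm : x m = 0)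
    (h : ∀ n, 0 ≤ altSum x m n) : ∃ r : ℤ → ℕ, ∀ j, x j = r j + r (j + 1) := by
  -- To the right of `m` the sum stops at the source of the map, otherwise at its target. Both `r m`
  -- and `r (m + 1)` equal `x m = 0`.
  refine ⟨fun j => (if m < j then altSum x m (j - 1 - m) else altSum x m (j - m)).toNat,
    fun j => ?_⟩
  zify
  rw [Int.toNat_of_nonneg (by split_ifs <;> apply h),
    Int.toNat_of_nonneg (by split_ifs <;> apply h)]
  rcases lt_trichotomy j m with hj | rfl | hj
  · have := altSum_pred x m (j + 1 - m) (by omega)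
    rw [if_neg (by omega), if_neg (by omega), add_comm]
    convert this.symm using 3 <;> ring
  · simp [altSum_zero, hm]
  · have := altSum_succ x m (j - 1 - m) (by omega)
    rw [if_pos (by omega), if_pos (by omega)]
    convert this.symm using 3 <;> ring_nf

lemma altSum_of_eq_add (x r : ℤ → ℕ) (hr : ∀ j, x j = r j + r (j + 1)) (m : ℤ) (hm : x m = 0)
    (n : ℤ) : 0 ≤ altSum x m n ∧ (x (m + n) = 0 → altSum x m n = 0) := by
  have h₀ := hr m
  have pos : ∀ k : ℕ, altSum x m k = r (m + k + 1) := by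
    intro k
    induction k with
    | zero => simp [altSum_zero]; omega
    | succ k ih =>
      have h₁ := altSum_succ x m k (by omega)
      have h₂ := hr (m + (k + 1))
      rw [ih] at h₁
      push_cast
      rw [show m + ((k : ℤ) + 1) = m + k + 1 by ring] at h₁ h₂ ⊢
      omega
  have neg : ∀ k : ℕ, altSum x m (-k) = r (m + (-k)) := by
    intro k
    induction k with
    | zero => simp [altSum_zero]; omega
    | succ k ih =>
      have h₁ := altSum_pred x m (-k) (by omega)
      have h₂ := hr (m + (-k - 1))
      rw [ih] at h₁
      rw [show m + (-(k : ℤ) - 1) + 1 = m + -k by ring] at h₂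
      push_cast
      rw [show -((k : ℤ) + 1) = -k - 1 by ring]
      omega
  have h₁ := hr (m + n)
  obtain ⟨k, rfl | rfl⟩ := n.eq_nat_or_neg
  · rw [pos]
    omega
  · rw [neg]
    omega

end AlternatingSums

/-! ### Rank decompositions along triangles and the rank of a morphism. -/

section RankSeq

variable {C : Type u} [Category.{v} C] [Preadditive C] [HasZeroObject C] [HasShift C ℤ]
  [∀ n : ℤ, (shiftFunctor C n).Additive] [Pretriangulated C]

/-- A decomposition of the values of `χ` along the sequence
`⋯ → A → B → D → ΣA → ⋯` into the ranks of the consecutive morphisms: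
`a n`, `b n`, `c n` are the ranks of the morphisms ending in
`Σⁿ A`, `Σⁿ B`, `Σⁿ D`, respectively. -/
structure IsRankSeq (χ : C → ℕ) (A B D : C) (a b c : ℤ → ℕ) : Prop where
  eq₁ : ∀ n : ℤ, χ (A⟦n⟧) = a n + b n
  eq₂ : ∀ n : ℤ, χ (B⟦n⟧) = b n + c n
  eq₃ : ∀ n : ℤ, χ (D⟦n⟧) = c n + a (n + 1)

lemma triangleSeq_three_mul (T : Triangle C) (n : ℤ) : triangleSeq T (3 * n) = T.obj₁⟦n⟧ := by
  simp [triangleSeq]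

lemma triangleSeq_three_mul_add_one (T : Triangle C) (n : ℤ) :
    triangleSeq T (3 * n + 1) = T.obj₂⟦n⟧ := by
  rw [triangleSeq, if_neg (by omega), if_pos (by omega), show (3 * n + 1) / 3 = n by omega]

lemma triangleSeq_three_mul_add_two (T : Triangle C) (n : ℤ) :
    triangleSeq T (3 * n + 2) = T.obj₃⟦n⟧ := by
  rw [triangleSeq, if_neg (by omega), if_neg (by omega), show (3 * n + 2) / 3 = n by omega]

lemma IsCohomologicalFunction.exists_isRankSeq {χ : C → ℕ} (hχ : IsCohomologicalFunction χ)
    (T : Triangle C) (hT : T ∈ distTriang C) :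
    ∃ a b c, IsRankSeq χ T.obj₁ T.obj₂ T.obj₃ a b c := by
  obtain ⟨m, hm⟩ := hχ.vanishing T.obj₁
  rw [← triangleSeq_three_mul] at hm
  obtain ⟨r, hr⟩ := exists_of_altSum_nonneg (fun j => χ (triangleSeq T j)) (3 * m) hm
    (fun n => (hχ.triangle T hT _ hm n).1)
  refine ⟨fun n => r (3 * n), fun n => r (3 * n + 1), fun n => r (3 * n + 2), ⟨?_, ?_, ?_⟩⟩
  · intro n
    rw [← triangleSeq_three_mul, hr]
  · intro n
    rw [← triangleSeq_three_mul_add_one, hr, add_assoc _ 1 1]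
    rfl
  · intro n
    rw [← triangleSeq_three_mul_add_two, hr, show 3 * n + 2 + 1 = 3 * (n + 1) by ring]

lemma IsCohomologicalFunction.of_isRankSeq {χ : C → ℕ}
    (biprod : ∀ (X Y : C) (b : BinaryBicone X Y), b.IsBilimit → χ b.pt = χ X + χ Y)
    (vanishing : ∀ X : C, ∃ n : ℤ, χ (X⟦n⟧) = 0)
    (H : ∀ T ∈ distTriang C, ∃ a b c, IsRankSeq χ T.obj₁ T.obj₂ T.obj₃ a b c) :
    IsCohomologicalFunction χ where
  biprod := biprod
  vanishing := vanishing
  triangle T hT m hm n := by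
    obtain ⟨a, b, c, h⟩ := H T hT
    refine altSum_of_eq_add (fun j => χ (triangleSeq T j)) (fun j => if j % 3 = 0 then a (j / 3)
      else if j % 3 = 1 then b (j / 3) else c (j / 3)) (fun j => ?_) m hm n
    obtain ⟨k, rfl | rfl | rfl⟩ : ∃ k, j = 3 * k ∨ j = 3 * k + 1 ∨ j = 3 * k + 2 :=
      ⟨j / 3, by omega⟩
    · rw [triangleSeq_three_mul, h.eq₁, if_pos (by omega), if_neg (by omega), if_pos (by omega)]
      congr <;> omega
    · rw [triangleSeq_three_mul_add_one, h.eq₂, if_neg (by omega), if_pos (by omega),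
        if_neg (by omega), if_neg (by omega)]
      congr <;> omega
    · rw [triangleSeq_three_mul_add_two, h.eq₃, if_neg (by omega), if_neg (by omega),
        if_pos (by omega)]
      congr <;> omega

variable {χ : C → ℕ}

lemma IsCohomologicalFunction.map_isZero (hχ : IsCohomologicalFunction χ) {X : C}
    (hX : IsZero X) : χ X = 0 := by
  have h := hχ.biprod X X (BinaryBicone.mk X 0 0 0 0 (hX.eq_of_src _ _) (hX.eq_of_src _ _)
    (hX.eq_of_src _ _) (hX.eq_of_src _ _)) (isBinaryBilimitOfTotal _ (hX.eq_of_src _ _))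
  dsimp at h
  omega

lemma IsCohomologicalFunction.map_iso (hχ : IsCohomologicalFunction χ) {X Y : C}
    (e : X ≅ Y) : χ X = χ Y := by
  have h := hχ.biprod X 0 (BinaryBicone.mk Y e.inv 0 e.hom 0 (by simp) (by simp) (by simp)
    ((isZero_zero C).eq_of_src _ _)) (isBinaryBilimitOfTotal _ (by simp))
  rw [hχ.map_isZero (isZero_zero C), add_zero] at h
  exact h.symm

lemma IsCohomologicalFunction.map_biprod_shift (hχ : IsCohomologicalFunction χ) (X Y : C)
    (n : ℤ) : χ ((X ⊞ Y)⟦n⟧) = χ (X⟦n⟧) + χ (Y⟦n⟧) := by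
  have := preservesBinaryBiproducts_of_preservesBiproducts (shiftFunctor C n)
  exact hχ.biprod _ _ ((shiftFunctor C n).mapBinaryBicone (BinaryBiproduct.bicone X Y))
    (isBinaryBilimitOfPreserves (shiftFunctor C n) (BinaryBiproduct.isBilimit X Y))

lemma IsCohomologicalFunction.vanishing₂ (hχ : IsCohomologicalFunction χ) (X Y : C) :
    ∃ n : ℤ, χ (X⟦n⟧) = 0 ∧ χ (Y⟦n⟧) = 0 := by
  obtain ⟨n, hn⟩ := hχ.vanishing (X ⊞ Y)
  rw [hχ.map_biprod_shift] at hn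
  exact ⟨n, by omega, by omega⟩

lemma eq_zero_of_forall_succ_eq_neg (d : ℤ → ℤ) (h : ∀ n, d (n + 1) = - d n) (n : ℤ)
    (hn : d n = 0) (m : ℤ) : d m = 0 := by
  have h₁ : ∀ k : ℕ, d (n + k) = 0 := fun k => by
    induction k with
    | zero => simpa using hn
    | succ k ih => push_cast; rw [← add_assoc, h, ih, neg_zero]
  have h₂ : ∀ k : ℕ, d (n + (-k)) = 0 := fun k => by
    induction k with
    | zero => simpa using hn
    | succ k ih =>
      have := h (n + (-(k + 1 : ℕ)))
      rw [show n + (-((k + 1 : ℕ) : ℤ)) + 1 = n + (-k) by push_cast; ring, ih] at this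
      omega
  obtain ⟨k, hk | hk⟩ := (m - n).eq_nat_or_neg
  · rw [show m = n + k by omega, h₁]
  · rw [show m = n + (-k) by omega, h₂]

/-- Three consecutive equations show that `b - b'` changes sign when `n` grows by one. It vanishes
wherever `χ (A⟦n⟧) = 0`, hence everywhere. -/
lemma IsRankSeq.unique {A B D : C} {a b c a' b' c' : ℤ → ℕ}
    (hA : ∃ n : ℤ, χ (A⟦n⟧) = 0) (h : IsRankSeq χ A B D a b c)
    (h' : IsRankSeq χ A B D a' b' c') : b = b' := by
  obtain ⟨n, hn⟩ := hA
  funext m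
  have := eq_zero_of_forall_succ_eq_neg (fun m => (b m : ℤ) - b' m) (fun m => by
    have := h.eq₁ (m + 1); have := h.eq₂ m; have := h.eq₃ m
    have := h'.eq₁ (m + 1); have := h'.eq₂ m; have := h'.eq₃ m
    omega) n (by have := h.eq₁ n; have := h'.eq₁ n; omega) m
  omega

lemma IsRankSeq.of_eq {A B D A' B' D' : C} {a b c : ℤ → ℕ} (h : IsRankSeq χ A B D a b c)
    (h₁ : ∀ n : ℤ, χ (A⟦n⟧) = χ (A'⟦n⟧)) (h₂ : ∀ n : ℤ, χ (B⟦n⟧) = χ (B'⟦n⟧))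
    (h₃ : ∀ n : ℤ, χ (D⟦n⟧) = χ (D'⟦n⟧)) : IsRankSeq χ A' B' D' a b c :=
  ⟨fun n => by rw [← h₁, h.eq₁], fun n => by rw [← h₂, h.eq₂], fun n => by rw [← h₃, h.eq₃]⟩

lemma IsRankSeq.rotate (hχ : IsCohomologicalFunction χ) {A B D : C} {a b c : ℤ → ℕ}
    (h : IsRankSeq χ A B D a b c) :
    IsRankSeq χ B D (A⟦(1 : ℤ)⟧) b c (fun n => a (n + 1)) :=
  ⟨h.eq₂, h.eq₃, fun n => by
    rw [← h.eq₁]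
    exact hχ.map_iso ((shiftFunctorAdd' C 1 n (n + 1) (by ring)).app A).symm⟩

variable (χ) in
/-- The rank of a morphism with respect to a cohomological function `χ`: the value on the
image of `Hom(-,f)` of the additive function on the abelianisation extending `χ`. -/
noncomputable def rank {A B : C} (f : A ⟶ B) : ℕ :=
  sInf {k | ∃ T ∈ distTriang C, ∃ a b c, IsRankSeq χ T.obj₁ T.obj₂ T.obj₃ a b c ∧
    Nonempty (Arrow.mk f ≅ Arrow.mk T.mor₁) ∧ k = b 0}

/-- The set defining `rank` is a singleton: the triangle on `f` is unique up to isomorphism, and its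
rank decomposition is unique. So any triangle and decomposition compute the rank. -/
lemma IsRankSeq.rank_eq (hχ : IsCohomologicalFunction χ) {T : Triangle C}
    (hT : T ∈ distTriang C) {a b c : ℤ → ℕ} (h : IsRankSeq χ T.obj₁ T.obj₂ T.obj₃ a b c)
    {A B : C} (f : A ⟶ B) (e : Arrow.mk f ≅ Arrow.mk T.mor₁) : rank χ f = b 0 := by
  have : {k | ∃ T ∈ distTriang C, ∃ a b c, IsRankSeq χ T.obj₁ T.obj₂ T.obj₃ a b c ∧
    Nonempty (Arrow.mk f ≅ Arrow.mk T.mor₁) ∧ k = b 0} = {b 0} := by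
    ext k
    constructor
    · rintro ⟨T', hT', a', b', c', h', ⟨e'⟩, rfl⟩
      obtain ⟨i, -⟩ := exists_iso_of_arrow_iso T' T hT' hT (e'.symm ≪≫ e)
      have h'' := h'.of_eq
        (fun n => hχ.map_iso ((shiftFunctor C n).mapIso (Triangle.π₁.mapIso i)))
        (fun n => hχ.map_iso ((shiftFunctor C n).mapIso (Triangle.π₂.mapIso i)))
        (fun n => hχ.map_iso ((shiftFunctor C n).mapIso (Triangle.π₃.mapIso i)))
      rw [h''.unique (hχ.vanishing _) h]
      rfl
    · rintro rfl
      exact ⟨T, hT, a, b, c, h, ⟨e⟩, rfl⟩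
  rw [rank, this, csInf_singleton]

end RankSeq

/-! ### Additivity and monotonicity of the rank. -/

section Rank

variable {C : Type u} [Category.{v} C] [Preadditive C] [HasZeroObject C] [HasShift C ℤ]
  [∀ n : ℤ, (shiftFunctor C n).Additive] [Pretriangulated C]
  {χ : C → ℕ}

lemma IsCohomologicalFunction.exists_isRankSeq_rank (hχ : IsCohomologicalFunction χ)
    {A B D : C} {f : A ⟶ B} {g : B ⟶ D} {h : D ⟶ A⟦(1 : ℤ)⟧}
    (hT : Triangle.mk f g h ∈ distTriang C) :
    ∃ a b c, IsRankSeq χ A B D a b c ∧ rank χ f = b 0 ∧ rank χ g = c 0 := by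
  obtain ⟨a, b, c, H⟩ := hχ.exists_isRankSeq _ hT
  exact ⟨a, b, c, H, H.rank_eq hχ hT f (Iso.refl _),
    IsRankSeq.rank_eq hχ (rot_of_distTriang _ hT) (H.rotate hχ) g (Iso.refl _)⟩

lemma IsCohomologicalFunction.eq_rank_add_rank (hχ : IsCohomologicalFunction χ)
    {A B D : C} {f : A ⟶ B} {g : B ⟶ D} {h : D ⟶ A⟦(1 : ℤ)⟧}
    (hT : Triangle.mk f g h ∈ distTriang C) : χ B = rank χ f + rank χ g := by
  obtain ⟨a, b, c, H, h₁, h₂⟩ := hχ.exists_isRankSeq_rank hT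
  rw [h₁, h₂, ← H.eq₂]
  exact hχ.map_iso ((shiftFunctorZero C ℤ).app B).symm

lemma IsCohomologicalFunction.rank_id (hχ : IsCohomologicalFunction χ) (A : C) :
    rank χ (𝟙 A) = χ A := by
  have h₁ := hχ.eq_rank_add_rank (contractible_distinguished A)
  have h₂ : χ 0 = rank χ (0 : A ⟶ 0) + rank χ (0 : (0 : C) ⟶ A⟦(1 : ℤ)⟧) :=
    hχ.eq_rank_add_rank (rot_of_distTriang _ (contractible_distinguished A))
  rw [hχ.map_isZero (isZero_zero C)] at h₂
  omega

/-- The additivity of the rank: for composable morphisms `f`, `g` and a weak kernel `k` of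
`f ≫ g`, the image of `k ≫ f` is the kernel of `im f ⟶ im (f ≫ g)`. -/
lemma exists_rank_eq_add [IsTriangulated C] {W A B : C} (f : W ⟶ A) (g : A ⟶ B) :
    ∃ (P : C) (k : P ⟶ W), (∀ (V : C) (a : V ⟶ W), a ≫ f ≫ g = 0 → ∃ t, a = t ≫ k) ∧
      k ≫ f ≫ g = 0 ∧
      ∀ χ : C → ℕ, IsCohomologicalFunction χ → rank χ f = rank χ (f ≫ g) + rank χ (k ≫ f) := by
  obtain ⟨P, k, d, h₁₂⟩ := distinguished_cocone_triangle₁ (f ≫ g)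
  obtain ⟨F, v, w, h₂₃⟩ := distinguished_cocone_triangle f
  obtain ⟨Q, v', w', h₁₃⟩ := distinguished_cocone_triangle (k ≫ f)
  refine ⟨P, k, fun V a ha => Triangle.coyoneda_exact₂ _ h₁₂ a ha,
    comp_distTriang_mor_zero₁₂ _ h₁₂, fun χ hχ => ?_⟩
  -- The octahedron on `k` and `f` yields a triangle from `B` to `Q` to `F` with this connecting
  -- map. As it is zero, `Q` is isomorphic to `B ⊞ F`.
  have hzero : w ≫ (f ≫ g)⟦(1 : ℤ)⟧' = 0 := by
    have : w ≫ f⟦(1 : ℤ)⟧' = 0 := comp_distTriang_mor_zero₃₁ _ h₂₃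
    rw [Functor.map_comp, reassoc_of% this, zero_comp]
  obtain ⟨e, -, -⟩ := exists_iso_binaryBiproduct_of_distTriang _
    (Triangulated.someOctahedron rfl h₁₂ h₂₃ h₁₃).mem hzero
  have hQ : ∀ n : ℤ, χ (Q⟦n⟧) = χ (B⟦n⟧) + χ (F⟦n⟧) := fun n => by
    rw [← hχ.map_biprod_shift]
    exact hχ.map_iso ((shiftFunctor C n).mapIso e)
  obtain ⟨a₁, b₁, c₁, H₁, -, r₁⟩ := hχ.exists_isRankSeq_rank h₁₂
  obtain ⟨a₂, b₂, c₂, H₂, r₂, -⟩ := hχ.exists_isRankSeq_rank h₂₃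
  obtain ⟨a₃, b₃, c₃, H₃, r₃, -⟩ := hχ.exists_isRankSeq_rank h₁₃
  rw [r₁, r₂, r₃]
  obtain ⟨n, hW, hA⟩ := hχ.vanishing₂ W A
  -- The defect of additivity alternates in sign, and vanishes where `χ` vanishes on the shifts of
  -- `W` and `A`.
  have := eq_zero_of_forall_succ_eq_neg (fun n => (b₂ n : ℤ) - c₁ n - b₃ n) (fun m => by
    have := H₁.eq₁ (m + 1); have := H₁.eq₂ (m + 1); have := H₁.eq₃ m
    have := H₂.eq₁ (m + 1); have := H₂.eq₂ m; have := H₂.eq₃ m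
    have := H₃.eq₁ (m + 1); have := H₃.eq₂ m; have := H₃.eq₃ m
    have := hQ m
    omega) n (by
      have := H₁.eq₂ n; have := H₂.eq₁ n; have := H₃.eq₂ n
      omega) 0
  omega

variable [IsTriangulated C]

lemma IsCohomologicalFunction.rank_comp_le_left (hχ : IsCohomologicalFunction χ)
    {W A B : C} (f : W ⟶ A) (g : A ⟶ B) : rank χ (f ≫ g) ≤ rank χ f := by
  obtain ⟨P, k, -, -, h⟩ := exists_rank_eq_add f g
  have := h χ hχ
  omega

/-- In `B` the ranks of `g` and of its weak cokernel add up to `χ B`, and likewise for `f ≫ g`. The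
weak cokernel of `g` factors through that of `f ≫ g`, which reduces the claim to
`rank_comp_le_left`. -/
lemma IsCohomologicalFunction.rank_comp_le_right (hχ : IsCohomologicalFunction χ)
    {W A B : C} (f : W ⟶ A) (g : A ⟶ B) : rank χ (f ≫ g) ≤ rank χ g := by
  obtain ⟨D, p, d, hT⟩ := distinguished_cocone_triangle g
  obtain ⟨D', p', d', hT'⟩ := distinguished_cocone_triangle (f ≫ g)
  have hp : g ≫ p = 0 := comp_distTriang_mor_zero₁₂ _ hT
  obtain ⟨t, ht⟩ : ∃ t, p = p' ≫ t := Triangle.yoneda_exact₂ _ hT' p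
    (show (f ≫ g) ≫ p = 0 by rw [Category.assoc, hp, comp_zero])
  have h₁ := hχ.eq_rank_add_rank hT
  have h₂ := hχ.eq_rank_add_rank hT'
  have h₃ : rank χ p ≤ rank χ p' := by
    rw [ht]
    exact hχ.rank_comp_le_left _ _
  omega

lemma IsCohomologicalFunction.rank_zero (hχ : IsCohomologicalFunction χ) (A B : C) :
    rank χ (0 : A ⟶ B) = 0 := by
  have h := hχ.rank_comp_le_left (0 : A ⟶ 0) (0 : (0 : C) ⟶ B)
  have h' := hχ.rank_comp_le_right (0 : A ⟶ 0) (𝟙 (0 : C))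
  rw [hχ.rank_id, hχ.map_isZero (isZero_zero C)] at h'
  rw [comp_zero] at h
  rw [Category.comp_id] at h'
  omega

end Rank

/-! ### Lengths of images under a functor. -/

section ImageLength

variable {C : Type u} [Category.{v} C] (H : Cᵒᵖ ⥤ AddCommGrpCat.{v})

/-- The length over `End(H)` of the image of `H(f)`. -/
noncomputable def imageLength {A B : C} (f : A ⟶ B) : ℕ :=
  (Module.length (End H) (LinearMap.range (mapLinear H f))).toNat

variable {H}

lemma length_range_ne_top (hH : ∀ X : C, IsFiniteLength (End H) (H.obj (Opposite.op X)))
    {A B : C} (f : A ⟶ B) :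
    Module.length (End H) (LinearMap.range (mapLinear H f)) ≠ ⊤ :=
  Module.length_ne_top_iff.2 ((hH A).of_injective (Submodule.subtype_injective _))

lemma imageLength_comp_le_left (hH : ∀ X : C, IsFiniteLength (End H) (H.obj (Opposite.op X)))
    {A B D : C} (f : A ⟶ B) (g : B ⟶ D) : imageLength H (f ≫ g) ≤ imageLength H f := by
  refine ENat.toNat_le_toNat ?_ (length_range_ne_top hH f)
  refine Module.length_le_of_injective (Submodule.inclusion ?_) (Submodule.inclusion_injective _)
  rw [mapLinear_comp]
  exact LinearMap.range_comp_le_range _ _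

lemma imageLength_comp_le_right (hH : ∀ X : C, IsFiniteLength (End H) (H.obj (Opposite.op X)))
    {A B D : C} (f : A ⟶ B) (g : B ⟶ D) : imageLength H (f ≫ g) ≤ imageLength H g := by
  refine ENat.toNat_le_toNat ?_ (length_range_ne_top hH g)
  rw [mapLinear_comp, LinearMap.range_comp]
  exact Module.length_le_of_surjective ((mapLinear H f).submoduleMap _)
    ((mapLinear H f).submoduleMap_surjective _)

lemma imageLength_eq_of_iso (hH : ∀ X : C, IsFiniteLength (End H) (H.obj (Opposite.op X)))
    {A B A' B' : C} {f : A ⟶ B} {f' : A' ⟶ B'} (e : A ≅ A') (e' : B ≅ B')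
    (comm : f ≫ e'.hom = e.hom ≫ f') : imageLength H f = imageLength H f' := by
  apply le_antisymm
  · rw [← cancel_mono e'.inv, Category.assoc, e'.hom_inv_id, Category.comp_id] at comm
    rw [comm]
    exact (imageLength_comp_le_left hH _ _).trans (imageLength_comp_le_right hH _ _)
  · rw [← cancel_epi e.inv, e.inv_hom_id_assoc] at comm
    rw [← comm]
    exact (imageLength_comp_le_right hH _ _).trans (imageLength_comp_le_left hH _ _)

variable [Preadditive C]

lemma imageLength_neg [H.Additive] {A B : C} (f : A ⟶ B) :
    imageLength H (-f) = imageLength H f := by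
  have : mapLinear H (-f) = - mapLinear H f := by
    ext x
    exact ConcreteCategory.congr_hom (H.map_neg (f := f.op)) x
  rw [imageLength, this, LinearMap.range_neg, imageLength]

lemma imageLength_units_smul [H.Additive] {A B : C} (f : A ⟶ B) (n : ℤ) :
    imageLength H (n.negOnePow • f) = imageLength H f := by
  rcases Int.even_or_odd n with hn | hn
  · rw [Int.negOnePow_even _ hn, one_smul]
  · rw [Int.negOnePow_odd _ hn, Units.neg_smul, one_smul, imageLength_neg]

lemma lengthFunction_biprod [H.Additive]
    (hH : ∀ X : C, IsFiniteLength (End H) (H.obj (Opposite.op X)))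
    (X Y : C) (b : BinaryBicone X Y) (hb : b.IsBilimit) :
    lengthFunction H b.pt = lengthFunction H X + lengthFunction H Y := by
  have add : ∀ {A B : C} (f g : A ⟶ B), mapLinear H (f + g) = mapLinear H f + mapLinear H g := by
    intro A B f g
    ext x
    exact ConcreteCategory.congr_hom (H.map_add (f := f.op) (g := g.op)) x
  have zero : ∀ {A B : C}, mapLinear H (0 : A ⟶ B) = 0 := by
    intro A B
    ext x
    exact ConcreteCategory.congr_hom (H.map_zero (Opposite.op B) (Opposite.op A)) x
  have h₁ : mapLinear H b.inl ∘ₗ mapLinear H b.fst = LinearMap.id := by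
    rw [← mapLinear_comp, b.inl_fst, mapLinear_id]
  have h₂ : mapLinear H b.inl ∘ₗ mapLinear H b.snd = 0 := by
    rw [← mapLinear_comp, b.inl_snd, zero]
  have h₃ : mapLinear H b.inr ∘ₗ mapLinear H b.fst = 0 := by
    rw [← mapLinear_comp, b.inr_fst, zero]
  have h₄ : mapLinear H b.inr ∘ₗ mapLinear H b.snd = LinearMap.id := by
    rw [← mapLinear_comp, b.inr_snd, mapLinear_id]
  have h₅ : mapLinear H b.fst ∘ₗ mapLinear H b.inl + mapLinear H b.snd ∘ₗ mapLinear H b.inr =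
      LinearMap.id := by
    rw [← mapLinear_comp, ← mapLinear_comp, ← add, IsBilimit.binary_total hb, mapLinear_id]
  let e : H.obj (Opposite.op b.pt) ≃ₗ[End H] H.obj (Opposite.op X) × H.obj (Opposite.op Y) :=
    LinearEquiv.ofLinearMap ((mapLinear H b.inl).prod (mapLinear H b.inr))
      ((mapLinear H b.fst).coprod (mapLinear H b.snd))
      (by rw [LinearMap.prod_comp, LinearMap.comp_coprod, LinearMap.comp_coprod, h₁, h₂, h₃, h₄]; ext <;> simp)
      (by rw [LinearMap.coprod_comp_prod, h₅])
  rw [lengthFunction, e.length_eq, Module.length_prod, ENat.toNat_add]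
  · rfl
  · exact Module.length_ne_top_iff.2 (hH X)
  · exact Module.length_ne_top_iff.2 (hH Y)

end ImageLength

/-! ### The length function of an endofinite functor is cohomological. -/

section Endofinite

variable {C : Type u} [Category.{v} C] [Preadditive C] [HasZeroObject C] [HasShift C ℤ]
  [∀ n : ℤ, (shiftFunctor C n).Additive] [Pretriangulated C]
  {H : Cᵒᵖ ⥤ AddCommGrpCat.{v}}

lemma IsEndofinite.additive (hH : IsEndofinite H) : H.Additive := by
  have := hH.cohomological
  infer_instance

lemma IsEndofinite.lengthFunction_eq (hH : IsEndofinite H) {A B D : C} {f : A ⟶ B} {g : B ⟶ D}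
    {h : D ⟶ A⟦(1 : ℤ)⟧} (hT : Triangle.mk f g h ∈ distTriang C) :
    lengthFunction H B = imageLength H f + imageLength H g := by
  have := hH.cohomological
  have hexact := H.map_distinguished_op_exact _ hT
  rw [ShortComplex.ab_exact_iff] at hexact
  have hker : LinearMap.ker (mapLinear H f) = LinearMap.range (mapLinear H g) := by
    ext x
    constructor
    · exact fun hx => hexact x hx
    · rintro ⟨y, rfl⟩
      have hzero : mapLinear H (f ≫ g) = 0 := by
        have : f ≫ g = 0 := comp_distTriang_mor_zero₁₂ _ hT
        rw [this]
        ext x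
        exact ConcreteCategory.congr_hom (H.map_zero (Opposite.op D) (Opposite.op A)) x
      rw [mapLinear_comp] at hzero
      exact LinearMap.congr_fun hzero y
  rw [lengthFunction, Module.length_eq_add_of_exact (LinearMap.ker (mapLinear H f)).subtype
    (mapLinear H f).rangeRestrict (Submodule.subtype_injective _)
    (LinearMap.surjective_rangeRestrict _)
    (by rw [LinearMap.exact_iff, LinearMap.ker_rangeRestrict, Submodule.range_subtype]),
    hker, ENat.toNat_add (length_range_ne_top hH.finite_length g)
    (length_range_ne_top hH.finite_length f), add_comm]
  rfl

lemma IsEndofinite.lengthFunction_shift_eq (hH : IsEndofinite H) (T : Triangle C)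
    (hT : T ∈ distTriang C) (n : ℤ) :
    lengthFunction H (T.obj₂⟦n⟧) = imageLength H (T.mor₁⟦n⟧') + imageLength H (T.mor₂⟦n⟧') := by
  have := hH.additive
  rw [← imageLength_units_smul _ n, ← imageLength_units_smul (T.mor₂⟦n⟧') n]
  exact hH.lengthFunction_eq (T.shift_distinguished hT n)

lemma lengthFunction_iso {A B : C} (e : A ≅ B) :
    lengthFunction H A = lengthFunction H B := by
  refine congr_arg ENat.toNat (LinearEquiv.length_eq (LinearEquiv.ofLinearMap
    (mapLinear H e.inv) (mapLinear H e.hom) ?_ ?_))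
  · rw [← mapLinear_comp, e.inv_hom_id, mapLinear_id]
  · rw [← mapLinear_comp, e.hom_inv_id, mapLinear_id]

lemma IsEndofinite.isRankSeq (hH : IsEndofinite H) (T : Triangle C) (hT : T ∈ distTriang C) :
    IsRankSeq (lengthFunction H) T.obj₁ T.obj₂ T.obj₃
      -- The map ending in `Σⁿ A` is the shift of `mor₃` by `n - 1`. Signs from rotating or shifting
      -- triangles do not change images.
      (fun n => imageLength H (T.mor₃⟦n - 1⟧')) (fun n => imageLength H (T.mor₁⟦n⟧'))
      (fun n => imageLength H (T.mor₂⟦n⟧')) where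
  eq₁ n := by
    have := hH.additive
    have h : lengthFunction H ((T.obj₁⟦(1 : ℤ)⟧)⟦n - 1⟧) = imageLength H (T.mor₃⟦n - 1⟧') +
        imageLength H ((-T.mor₁⟦(1 : ℤ)⟧')⟦n - 1⟧') := hH.lengthFunction_shift_eq _
      (rot_of_distTriang _ (rot_of_distTriang _ hT)) (n - 1)
    rw [lengthFunction_iso ((shiftFunctorAdd' C 1 (n - 1) n (by ring)).app T.obj₁),
      Functor.comp_obj, h, Functor.map_neg, imageLength_neg]
    congr 1
    exact imageLength_eq_of_iso hH.finite_length
      ((shiftFunctorAdd' C 1 (n - 1) n (by ring)).app T.obj₁).symm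
      ((shiftFunctorAdd' C 1 (n - 1) n (by ring)).app T.obj₂).symm
      ((shiftFunctorAdd' C 1 (n - 1) n (by ring)).inv.naturality T.mor₁)
  eq₂ n := hH.lengthFunction_shift_eq T hT n
  eq₃ n := by
    rw [add_sub_cancel_right]
    exact hH.lengthFunction_shift_eq _ (rot_of_distTriang _ hT) n

lemma IsEndofinite.isCohomologicalFunction (hH : IsEndofinite H) :
    IsCohomologicalFunction (lengthFunction H) := by
  have := hH.additive
  refine IsCohomologicalFunction.of_isRankSeq (lengthFunction_biprod hH.finite_length) ?_
    (fun T hT => ⟨_, _, _, hH.isRankSeq T hT⟩)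
  intro X
  obtain ⟨n, hn⟩ := hH.vanishing X
  have := AddCommGrpCat.subsingleton_of_isZero hn
  exact ⟨n, by rw [lengthFunction, Module.length_eq_zero]; rfl⟩

lemma IsEndofinite.rank_eq (hH : IsEndofinite H) {A B : C} (f : A ⟶ B) :
    rank (lengthFunction H) f = imageLength H f := by
  obtain ⟨D, g, h, hT⟩ := distinguished_cocone_triangle f
  rw [(hH.isRankSeq _ hT).rank_eq hH.isCohomologicalFunction hT f (Iso.refl _)]
  exact imageLength_eq_of_iso hH.finite_length ((shiftFunctorZero C ℤ).app A)
    ((shiftFunctorZero C ℤ).app B) ((shiftFunctorZero C ℤ).hom.naturality f)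

end Endofinite

/-! ### Differences and sums of cohomological functions. -/

section Operations

variable {C : Type u} [Category.{v} C] [Preadditive C] [HasZeroObject C] [HasShift C ℤ]
  [∀ n : ℤ, (shiftFunctor C n).Additive] [Pretriangulated C] {χ ψ : C → ℕ}

lemma IsRankSeq.shift (hχ : IsCohomologicalFunction χ) {A B D : C} {a b c : ℤ → ℕ}
    (h : IsRankSeq χ A B D a b c) (m : ℤ) :
    IsRankSeq χ (A⟦m⟧) (B⟦m⟧) (D⟦m⟧) (fun n => a (m + n)) (fun n => b (m + n))
      (fun n => c (m + n)) := by
  have H : ∀ (X : C) (n : ℤ), χ ((X⟦m⟧)⟦n⟧) = χ (X⟦m + n⟧) := fun X n =>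
    hχ.map_iso ((shiftFunctorAdd C m n).app X).symm
  exact ⟨fun n => by rw [H, h.eq₁], fun n => by rw [H, h.eq₂],
    fun n => by rw [H, h.eq₃, add_assoc]⟩

lemma IsRankSeq.le_of_rank_le (hχ : IsCohomologicalFunction χ) (hψ : IsCohomologicalFunction ψ)
    (H : ∀ {A B : C} (f : A ⟶ B), rank ψ f ≤ rank χ f)
    {T : Triangle C} (hT : T ∈ distTriang C) {a b c a' b' c' : ℤ → ℕ}
    (h : IsRankSeq χ T.obj₁ T.obj₂ T.obj₃ a b c)
    (h' : IsRankSeq ψ T.obj₁ T.obj₂ T.obj₃ a' b' c') (n : ℤ) : b' n ≤ b n := by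
  have h₁ := IsRankSeq.rank_eq hχ (T.shift_distinguished hT n) (h.shift hχ n) _ (Iso.refl _)
  have h₂ := IsRankSeq.rank_eq hψ (T.shift_distinguished hT n) (h'.shift hψ n) _ (Iso.refl _)
  rw [add_zero] at h₁ h₂
  rw [← h₁, ← h₂]
  exact H _

/-- Rank decompositions may be subtracted term by term: each term is the rank of a morphism in a
shifted or rotated triangle, so the truncated subtractions are genuine. -/
lemma IsCohomologicalFunction.sub (hχ : IsCohomologicalFunction χ)
    (hψ : IsCohomologicalFunction ψ)
    (H : ∀ {A B : C} (f : A ⟶ B), rank ψ f ≤ rank χ f) :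
    IsCohomologicalFunction (fun X => χ X - ψ X) := by
  have hle : ∀ X, ψ X ≤ χ X := fun X => by
    rw [← hχ.rank_id, ← hψ.rank_id]
    exact H _
  refine IsCohomologicalFunction.of_isRankSeq ?_ ?_ ?_
  · intro X Y b hb
    have := hχ.biprod X Y b hb; have := hψ.biprod X Y b hb
    have := hle X; have := hle Y
    omega
  · intro X
    obtain ⟨n, hn⟩ := hχ.vanishing X
    exact ⟨n, by omega⟩
  · intro T hT
    obtain ⟨a, b, c, h⟩ := hχ.exists_isRankSeq T hT
    obtain ⟨a', b', c', h'⟩ := hψ.exists_isRankSeq T hT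
    have hb : ∀ n, b' n ≤ b n := IsRankSeq.le_of_rank_le hχ hψ H hT h h'
    have hc : ∀ n, c' n ≤ c n := IsRankSeq.le_of_rank_le hχ hψ H (rot_of_distTriang _ hT)
      (h.rotate hχ) (h'.rotate hψ)
    have ha : ∀ n, a' (n + 1) ≤ a (n + 1) := IsRankSeq.le_of_rank_le hχ hψ H
      (rot_of_distTriang _ (rot_of_distTriang _ hT)) ((h.rotate hχ).rotate hχ)
      ((h'.rotate hψ).rotate hψ)
    refine ⟨fun n => a n - a' n, fun n => b n - b' n, fun n => c n - c' n, ?_, ?_, ?_⟩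
    · intro n
      have := h.eq₁ n; have := h'.eq₁ n; have := hb n; have := ha (n - 1)
      rw [sub_add_cancel] at this
      omega
    · intro n
      have := h.eq₂ n; have := h'.eq₂ n; have := hb n; have := hc n
      omega
    · intro n
      have := h.eq₃ n; have := h'.eq₃ n; have := ha n; have := hc n
      omega

lemma IsCohomologicalFunction.rank_add (hχ : IsCohomologicalFunction χ)
    (hψ : IsCohomologicalFunction ψ) (h : IsCohomologicalFunction (χ + ψ)) {A B : C}
    (f : A ⟶ B) : rank (χ + ψ) f = rank χ f + rank ψ f := by
  obtain ⟨D, g, d, hT⟩ := distinguished_cocone_triangle f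
  obtain ⟨a, b, c, h₁, r₁, -⟩ := hχ.exists_isRankSeq_rank hT
  obtain ⟨a', b', c', h₂, r₂, -⟩ := hψ.exists_isRankSeq_rank hT
  have : IsRankSeq (χ + ψ) A B D (a + a') (b + b') (c + c') := by
    refine ⟨fun n => ?_, fun n => ?_, fun n => ?_⟩ <;>
    simp only [Pi.add_apply, h₁.eq₁, h₁.eq₂, h₁.eq₃, h₂.eq₁, h₂.eq₂, h₂.eq₃] <;> ring
  rw [r₁, r₂]
  exact IsRankSeq.rank_eq h hT this f (Iso.refl _)

end Operations

/-! ### Fitting's lemma and the socle of an indecomposable representable. -/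

section Indecomposable

/-- Once the left and right ideals of powers of `x` stabilize, a high power `y` satisfies `y = t *
y² = y² * t'`, so `t * y = y * t'` is idempotent. If it is 0, `x` is nilpotent; if it is 1, `y` is a
unit. -/
lemma isUnit_or_isUnit_one_sub {R : Type*} [Ring R] (hR : ∀ p : R, p * p = p → p = 0 ∨ p = 1)
    (x : R) (n n' : ℕ) (hn : ∀ m, ∃ t, x ^ n = t * x ^ (n + m))
    (hn' : ∀ m, ∃ t, x ^ n' = x ^ (n' + m) * t) : IsUnit x ∨ IsUnit (1 - x) := by
  -- The extra 1 makes the exponent positive, so that `y` being a unit implies the same for `x`.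
  obtain ⟨y, hy⟩ : ∃ y, y = x ^ (n + n' + 1) := ⟨_, rfl⟩
  obtain ⟨t, ht⟩ : ∃ t, y = t * (y * y) := by
    obtain ⟨t, ht⟩ := hn (n + n' + 1)
    refine ⟨t, ?_⟩
    rw [hy, ← pow_add, show n + n' + 1 + (n + n' + 1) = (n + (n + n' + 1)) + (n' + 1) by ring,
      pow_add x (n + (n + n' + 1)), ← mul_assoc, ← ht, ← pow_add, add_assoc]
  obtain ⟨t', ht'⟩ : ∃ t', y = (y * y) * t' := by
    obtain ⟨t', ht'⟩ := hn' (n + n' + 1)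
    refine ⟨t', ?_⟩
    rw [hy, ← pow_add, show n + n' + 1 + (n + n' + 1) = (n + 1) + (n' + (n + n' + 1)) by ring,
      pow_add x (n + 1), mul_assoc, ← ht', ← pow_add]
    congr 1
    ring
  have h₁ : t * y = y * t' := by
    calc t * y = t * ((y * y) * t') := by rw [← ht']
      _ = t * (y * y) * t' := (mul_assoc _ _ _).symm
      _ = y * t' := by rw [← ht]
  rcases hR (y * t') (by
    calc y * t' * (y * t') = t * y * (y * t') := by rw [h₁]
      _ = t * (y * y) * t' := by simp only [mul_assoc]
      _ = y * t' := by rw [← ht]) with h | h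
  · right
    have hnil : IsNilpotent x := ⟨n + n' + 1, by rw [← hy, ht', mul_assoc, h, mul_zero]⟩
    exact hnil.isUnit_one_sub
  · left
    have hunit : IsUnit y := ⟨⟨y, t', h, by
      have : t = t' := left_inv_eq_right_inv (h₁.trans h) h
      rw [← this, h₁, h]⟩, rfl⟩
    rw [hy] at hunit
    exact (isUnit_pow_iff (by omega)).1 hunit

variable {C : Type u} [Category.{v} C] [Preadditive C] [HasZeroObject C] [HasShift C ℤ]
  [∀ n : ℤ, (shiftFunctor C n).Additive] [Pretriangulated C]

lemma eq_zero_or_eq_id_of_idempotent [IsIdempotentComplete C] {X : C} (hX : Indecomposable X)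
    (p : X ⟶ X) (hp : p ≫ p = p) : p = 0 ∨ p = 𝟙 X := by
  obtain ⟨Y, i, e, h₁, h₂⟩ := IsIdempotentComplete.idempotents_split X p hp
  obtain ⟨Y', i', e', h₁', h₂'⟩ := IsIdempotentComplete.idempotents_split X (𝟙 X - p)
    (Idempotents.idem_of_id_sub_idem p hp)
  have hm : Mono i := ⟨fun a b h => by simpa [h₁] using congr_arg (· ≫ e) h⟩
  have hm' : Mono i' := ⟨fun a b h => by simpa [h₁'] using congr_arg (· ≫ e') h⟩
  have hi : i ≫ e' = 0 := by
    rw [← cancel_mono i', Category.assoc, h₂', Preadditive.comp_sub, ← h₂, reassoc_of% h₁,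
      Category.comp_id, sub_self, zero_comp]
  have hi' : i' ≫ e = 0 := by
    have h₃ : p = 𝟙 X - e' ≫ i' := by rw [h₂']; abel
    rw [← cancel_mono i, Category.assoc, h₂, h₃, Preadditive.comp_sub, reassoc_of% h₁',
      Category.comp_id, sub_self, zero_comp]
  have iso : X ≅ Y ⊞ Y' :=
    { hom := biprod.lift e e'
      inv := biprod.desc i i'
      hom_inv_id := by rw [biprod.lift_desc, h₂, h₂']; abel
      inv_hom_id := by ext <;> simp [h₁, h₁', hi, hi'] }
  rcases hX.2 Y Y' iso with h | h
  · left
    rw [← h₂, h.eq_of_tgt e 0, zero_comp]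
  · right
    rw [h.eq_of_tgt e' 0, zero_comp] at h₂'
    exact (sub_eq_zero.1 h₂'.symm).symm

lemma isIso_or_isIso_id_sub [IsIdempotentComplete C] (hfin : IsLocallyFinite C) {X : C}
    (hX : Indecomposable X) (e : X ⟶ X) : IsIso e ∨ IsIso (𝟙 X - e) := by
  obtain ⟨n, hn⟩ : ∃ n, ∀ m, ∃ t : End X, (End.of e) ^ n = t * (End.of e) ^ (n + m) := by
    -- The target `Z` varies, so "being a power of `e`" is expressed by mutual factorization.
    obtain ⟨Z, f, ⟨n, ⟨s, hs⟩, ⟨t, ht⟩⟩, hf⟩ := exists_minimal_under hfin X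
      (fun Z f => ∃ n, (∃ s, f = ((End.of e) ^ n : End X).asHom ≫ s) ∧
        ∃ t, ((End.of e) ^ n : End X).asHom = f ≫ t) ⟨X, 𝟙 X, 0, ⟨𝟙 X, (Category.id_comp _).symm⟩,
          𝟙 X, (Category.id_comp _).symm⟩
    refine ⟨n, fun m => ?_⟩
    obtain ⟨r, hr⟩ := hf X ((End.of e) ^ (n + m) : End X).asHom
      ⟨n + m, ⟨𝟙 X, (Category.comp_id _).symm⟩, 𝟙 X, (Category.comp_id _).symm⟩
      ⟨t ≫ ((End.of e) ^ m : End X).asHom, by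
        rw [← Category.assoc, ← ht, add_comm, pow_add]; rfl⟩
    exact ⟨End.of (r ≫ t), by rw [show (End.of e) ^ n = f ≫ t from ht, hr]; exact Category.assoc _ _ _⟩
  obtain ⟨n', hn'⟩ : ∃ n, ∀ m, ∃ t : End X, (End.of e) ^ n = (End.of e) ^ (n + m) * t := by
    obtain ⟨Z, f, ⟨n, ⟨s, hs⟩, ⟨t, ht⟩⟩, hf⟩ := exists_minimal_over hfin X
      (fun Z f => ∃ n, (∃ s, f = s ≫ ((End.of e) ^ n : End X).asHom) ∧
        ∃ t, ((End.of e) ^ n : End X).asHom = t ≫ f) ⟨X, 𝟙 X, 0, ⟨𝟙 X, (Category.id_comp _).symm⟩,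
          𝟙 X, (Category.id_comp _).symm⟩
    refine ⟨n, fun m => ?_⟩
    obtain ⟨r, hr⟩ := hf X ((End.of e) ^ (n + m) : End X).asHom
      ⟨n + m, ⟨𝟙 X, (Category.id_comp _).symm⟩, 𝟙 X, (Category.id_comp _).symm⟩
      ⟨((End.of e) ^ m : End X).asHom ≫ t, by
        rw [Category.assoc, ← ht, pow_add]; rfl⟩
    exact ⟨End.of (t ≫ r), by
      rw [show (End.of e) ^ n = t ≫ f from ht, hr]; exact (Category.assoc _ _ _).symm⟩
  rcases isUnit_or_isUnit_one_sub (R := End X) (fun p hp => eq_zero_or_eq_id_of_idempotent hX p hp)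
    (End.of e) n n' hn hn' with h | h
  · exact Or.inl ((isUnit_iff_isIso e).1 h)
  · exact Or.inr ((isUnit_iff_isIso (𝟙 X - e)).1 h)

/-- `s : W ⟶ X` generates the socle of `Hom(-,X)`, and this socle is simple and essential. -/
structure IsSocle {W X : C} (s : W ⟶ X) : Prop where
  ne_zero : s ≠ 0
  exists_factor : ∀ {D : C} (h : D ⟶ X), h ≠ 0 → ∃ t, s = t ≫ h

lemma exists_isSocle [IsIdempotentComplete C] (hfin : IsLocallyFinite C) {X : C}
    (hX : Indecomposable X) : ∃ (W : C) (s : W ⟶ X), IsSocle s := by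
  obtain ⟨W, s, hs, hmin⟩ := exists_minimal_over hfin X (fun Z f => f ≠ 0)
    ⟨X, 𝟙 X, fun h => hX.1 ((IsZero.iff_id_eq_zero X).2 h)⟩
  refine ⟨W, s, hs, fun {D} h hh => ?_⟩
  by_contra! hsh
  -- The images of `s` and `h` meet trivially: by minimality, a common non-zero part would give back
  -- `s` as a multiple of `h`.
  have key : ∀ (V : C) (a : V ⟶ W) (b : V ⟶ D), a ≫ s + b ≫ h = 0 → a ≫ s = 0 := by
    intro V a b hab
    by_contra has
    obtain ⟨t, ht⟩ := hmin V (a ≫ s) has ⟨a, rfl⟩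
    apply hsh (t ≫ (-b))
    rw [eq_neg_of_add_eq_zero_left hab] at ht
    rw [ht]
    simp
  -- By injectivity, the projection of the direct sum of the two images onto that of `s` extends to
  -- an endomorphism `e` of `X`. It fixes `s` and kills `h`, so neither `e` nor `1 - e` is
  -- invertible.
  obtain ⟨e, he⟩ := exists_factor_of_kernel_le (biprod.desc s h) (biprod.desc s (0 : D ⟶ X)) (by
    intro V a ha
    have h₁ : a = biprod.lift (a ≫ biprod.fst) (a ≫ biprod.snd) := by ext <;> simp
    rw [h₁, biprod.lift_desc] at ha ⊢
    rw [comp_zero, add_zero]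
    exact key _ _ _ ha)
  have h₁ : s = s ≫ e := by simpa using congr_arg (biprod.inl ≫ ·) he
  have h₂ : 0 = h ≫ e := by simpa using congr_arg (biprod.inr ≫ ·) he
  rcases isIso_or_isIso_id_sub hfin hX e with _ | _
  · exact hh ((cancel_mono e).1 (by rw [← h₂, zero_comp]))
  · exact hs ((cancel_mono (𝟙 X - e)).1 (by
      rw [Preadditive.comp_sub, ← h₁, Category.comp_id, sub_self, zero_comp]))

end Indecomposable

/-! ### Comparing a cohomological function with `χ_X` by means of the socle. -/

section Socle

variable {C : Type u} [Category.{v} C] [Preadditive C] [HasZeroObject C] [HasShift C ℤ]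
  [∀ n : ℤ, (shiftFunctor C n).Additive] [Pretriangulated C] {χ : C → ℕ}

lemma factoring_le_iff {X A : C} (u : A ⟶ X)
    (U : Submodule (End (preadditiveYoneda.obj X))
      ((preadditiveYoneda.obj X).obj (Opposite.op A))) :
    factoring X u ≤ U ↔ (show (preadditiveYoneda.obj X).obj (Opposite.op A) from u) ∈ U := by
  constructor
  · exact fun h => h ((mem_factoring u u).2 ⟨𝟙 X, (Category.comp_id u).symm⟩)
  · rintro h _ ⟨e, rfl⟩
    exact U.smul_mem (preadditiveYoneda.map e) h

lemma factoring_ne_bot_iff {X A Z : C} (f : A ⟶ Z) :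
    factoring X f ≠ ⊥ ↔ ∃ e : Z ⟶ X, f ≫ e ≠ 0 := by
  rw [Submodule.ne_bot_iff]
  constructor
  · rintro ⟨_, ⟨e, rfl⟩, h⟩
    exact ⟨e, h⟩
  · rintro ⟨e, h⟩
    exact ⟨_, ⟨e, rfl⟩, h⟩

lemma imageLength_eq_one {X A : C} (u : A ⟶ X) (hu : u ≠ 0)
    (h : ∀ e : X ⟶ X, u ≫ e ≠ 0 → ∃ e', u = (u ≫ e) ≫ e') :
    imageLength (preadditiveYoneda.obj X) u = 1 := by
  have hatom : IsAtom (factoring X u) := by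
    refine ⟨(factoring_ne_bot_iff u).2 ⟨𝟙 X, by rwa [Category.comp_id]⟩, fun V hV => ?_⟩
    by_contra hV'
    obtain ⟨v, hv, hv'⟩ := (Submodule.ne_bot_iff _).1 hV'
    obtain ⟨e, rfl⟩ := hV.le hv
    obtain ⟨e', he'⟩ := h e hv'
    refine hV.not_ge ((factoring_le_iff u V).2 ?_)
    exact (congr_arg (· ∈ V) he').mpr (V.smul_mem (preadditiveYoneda.map e') hv)
  have : IsSimpleModule (End (preadditiveYoneda.obj X)) (factoring X u) :=
    isSimpleModule_iff_isAtom.2 hatom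
  have h₁ : Module.length (End (preadditiveYoneda.obj X)) (factoring X u) = 1 :=
    Module.length_eq_one _ _
  exact congr_arg ENat.toNat h₁

lemma imageLength_ne_zero_iff (hfin : IsLocallyFinite C) {X A B : C} (f : A ⟶ B) :
    imageLength (preadditiveYoneda.obj X) f ≠ 0 ↔ ∃ e : B ⟶ X, f ≫ e ≠ 0 := by
  have := isNoetherian_yoneda hfin X A
  have := isArtinian_yoneda hfin X A
  have h : Module.length (End (preadditiveYoneda.obj X)) (factoring X f) ≠ ⊤ :=
    Module.length_ne_top
  have h' : imageLength (preadditiveYoneda.obj X) f =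
    (Module.length (End (preadditiveYoneda.obj X)) (factoring X f)).toNat := rfl
  rw [← factoring_ne_bot_iff, h', Ne, ENat.toNat_eq_zero, or_iff_left h,
    Module.length_eq_zero_iff, Submodule.subsingleton_iff_eq_bot]

lemma IsSocle.eq_zero_of_comp_eq_zero {W X : C} {s : W ⟶ X} (hs : IsSocle s) {Y : C} (e : X ⟶ Y)
    (he : s ≫ e ≠ 0) {D : C} (h : D ⟶ X) (hh : h ≫ e = 0) : h = 0 := by
  by_contra h'
  obtain ⟨t, rfl⟩ := hs.exists_factor h h'
  exact he (by rw [Category.assoc, hh, comp_zero])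

lemma IsSocle.imageLength_eq_one {W X : C} {s : W ⟶ X} (hs : IsSocle s) :
    imageLength (preadditiveYoneda.obj X) s = 1 := by
  refine CohFun.imageLength_eq_one s hs.ne_zero fun e he => ?_
  refine exists_factor_of_kernel_le _ _ fun V a ha => ?_
  rw [← Category.assoc] at ha
  exact hs.eq_zero_of_comp_eq_zero e he _ ha

variable [IsTriangulated C]

/-- A cohomological function `χ` which does not vanish on the socle of `Hom(-,X)` dominates
the function `χ_X`. -/
lemma imageLength_le_rank (hfin : IsLocallyFinite C)
    (hvan : ∀ X Y : C, ∃ n : ℤ, ∀ f : X ⟶ Y⟦n⟧, f = 0) (hχ : IsCohomologicalFunction χ)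
    {W X : C} {s : W ⟶ X} (hs : IsSocle s) (h : rank χ s ≠ 0) (n : ℕ) :
    ∀ {A B : C} (f : A ⟶ B), imageLength (preadditiveYoneda.obj X) f = n → n ≤ rank χ f := by
  have hH := isEndofinite_yoneda hfin hvan X
  induction n with
  | zero => exact fun _ _ => Nat.zero_le _
  | succ n ih =>
    intro A B f hf
    have := isArtinian_yoneda hfin X A
    -- A simple submodule of the image is generated by some `f ≫ t` of length 1. Additivity leaves
    -- length `n` for `k ≫ f`, while `f ≫ t` contributes at least 1 to `rank χ f`, since `s` factors
    -- through it.
    obtain ⟨U, hU, hUf⟩ := (eq_bot_or_exists_atom_le (factoring X f)).resolve_left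
      ((factoring_ne_bot_iff f).2 ((imageLength_ne_zero_iff hfin f).1 (by omega)))
    obtain ⟨u, hu, hu'⟩ := (Submodule.ne_bot_iff _).1 hU.1
    obtain ⟨(t : B ⟶ X), rfl⟩ := hUf hu
    have h₁ : imageLength (preadditiveYoneda.obj X) (f ≫ t) = 1 := by
      refine imageLength_eq_one _ hu' fun e he => ?_
      have he' : factoring X ((f ≫ t) ≫ e) ≤ U :=
        (factoring_le_iff _ U).2 (U.smul_mem (preadditiveYoneda.map e) hu)
      rcases hU.le_iff.1 he' with h | h
      · exact absurd h ((factoring_ne_bot_iff _).2 ⟨𝟙 X, by rwa [Category.comp_id]⟩)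
      · exact (mem_factoring _ _).1 (h.symm ▸ hu)
    obtain ⟨P, k, -, -, hk⟩ := exists_rank_eq_add f t
    have h₂ := hk _ hH.isCohomologicalFunction
    rw [hH.rank_eq, hH.rank_eq, hH.rank_eq] at h₂
    have h₃ := ih (k ≫ f) (by omega)
    have h₄ := hk χ hχ
    obtain ⟨r, hr⟩ := hs.exists_factor (f ≫ t) hu'
    have h₅ : rank χ s ≤ rank χ (f ≫ t) := by
      rw [hr]
      exact hχ.rank_comp_le_right _ _
    omega

lemma indecomposable_of_forall_summand {Y : C} (hY : ¬ IsZero Y) {W : C} (h : W ⟶ Y)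
    (hh : h ≠ 0) (H : ∀ (Y' : C) (i : Y' ⟶ Y) (r : Y ⟶ Y'), i ≫ r = 𝟙 Y' → h ≫ r ≠ 0 →
      r ≫ i = 𝟙 Y) : Indecomposable Y := by
  refine ⟨hY, fun Y₁ Y₂ φ => ?_⟩
  have key : h ≫ φ.hom ≫ biprod.fst ≠ 0 ∨ h ≫ φ.hom ≫ biprod.snd ≠ 0 := by
    by_contra! hcon
    apply hh
    rw [← cancel_mono φ.hom]
    ext
    · simpa using hcon.1
    · simpa using hcon.2
  rcases key with h₁ | h₂
  · right
    have := H Y₁ (biprod.inl ≫ φ.inv) (φ.hom ≫ biprod.fst) (by simp) h₁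
    rw [IsZero.iff_id_eq_zero]
    symm
    simpa using (biprod.inr ≫ φ.inv) ≫= this =≫ (φ.hom ≫ biprod.snd)
  · left
    have := H Y₂ (biprod.inr ≫ φ.inv) (φ.hom ≫ biprod.snd) (by simp) h₂
    rw [IsZero.iff_id_eq_zero]
    symm
    simpa using (biprod.inl ≫ φ.inv) ≫= this =≫ (φ.hom ≫ biprod.fst)

/-- A non-zero cohomological function takes a non-zero value on a simple object of the
abelianisation, and this simple object is the image of a morphism. -/
lemma exists_simple_image (hfin : IsLocallyFinite C) (hχ : IsCohomologicalFunction χ)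
    (h : χ ≠ 0) : ∃ (W Z : C) (f : W ⟶ Z), rank χ f ≠ 0 ∧
      ∀ (V : C) (a : V ⟶ W), a ≫ f ≠ 0 → ∃ t, f = t ≫ a ≫ f := by
  obtain ⟨A, hA⟩ := Function.ne_iff.1 h
  obtain ⟨W, f, hf, hfmin⟩ := exists_minimal_over hfin A (fun _ f => rank χ f ≠ 0)
    ⟨A, 𝟙 A, by rwa [hχ.rank_id]⟩
  -- After a minimal subobject with `χ` non-zero, take a minimal quotient of it with this property.
  -- Dividing by a non-zero subobject then gives rank 0, so that subobject has non-zero rank and is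
  -- everything.
  obtain ⟨Z, g, ⟨⟨q, rfl⟩, hg⟩, hgmin⟩ := exists_minimal_under hfin W
    (fun Z g => (∃ q, g = f ≫ q) ∧ rank χ g ≠ 0) ⟨A, f, ⟨𝟙 A, (Category.comp_id f).symm⟩, hf⟩
  refine ⟨W, Z, f ≫ q, hg, fun V a ha => ?_⟩
  obtain ⟨Z', p, hp, hp', -⟩ := exists_weakCokernel (a ≫ f ≫ q)
  obtain ⟨P, k, -, hk, hrank⟩ := exists_rank_eq_add (f ≫ q) p
  have h₁ : rank χ ((f ≫ q) ≫ p) = 0 := by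
    by_contra h₁
    obtain ⟨t, ht⟩ := hgmin Z' ((f ≫ q) ≫ p) ⟨⟨q ≫ p, Category.assoc _ _ _⟩, h₁⟩ ⟨p, rfl⟩
    apply ha
    rw [ht, ← Category.assoc, ← Category.assoc a, hp, zero_comp]
  have h₂ := hrank χ hχ
  have h₃ : rank χ (k ≫ f) ≠ 0 := by
    have := hχ.rank_comp_le_left (k ≫ f) q
    rw [Category.assoc] at this
    omega
  obtain ⟨t, ht⟩ := hfmin P (k ≫ f) h₃ ⟨k, rfl⟩
  obtain ⟨t', ht'⟩ := hp' P (k ≫ f ≫ q) (by simpa using hk)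
  refine ⟨t ≫ t', ?_⟩
  rw [Category.assoc, ← ht', ← Category.assoc k, ← Category.assoc t, ← ht]

/-- A non-zero cohomological function does not vanish on all socles of the functors `Hom(-,X)`
with `X` indecomposable. -/
lemma exists_isSocle_rank_ne_zero [IsIdempotentComplete C] (hfin : IsLocallyFinite C)
    (hχ : IsCohomologicalFunction χ) (h : χ ≠ 0) :
    ∃ (X : C), Indecomposable X ∧ ∃ (W : C) (s : W ⟶ X), IsSocle s ∧ rank χ s ≠ 0 := by
  obtain ⟨W, Z, f, hf, hsimple⟩ := exists_simple_image hfin hχ h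
  have hf₀ : f ≠ 0 := by
    rintro rfl
    exact hf (hχ.rank_zero _ _)
  -- A minimal direct summand of `Z` on which `f` stays non-zero is indecomposable. The simple image
  -- of `f` embeds in Hom(-,Y), so it is the socle.
  obtain ⟨Y, i, ⟨r, hir, hr⟩, hmin⟩ := exists_minimal_over hfin Z
    (fun Y i => ∃ r : Z ⟶ Y, i ≫ r = 𝟙 Y ∧ f ≫ r ≠ 0)
    ⟨Z, 𝟙 Z, 𝟙 Z, Category.comp_id _, by rwa [Category.comp_id]⟩
  have hY : Indecomposable Y := by
    refine indecomposable_of_forall_summand (fun hY => hr (hY.eq_of_tgt _ _)) (f ≫ r) hr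
      fun Y' i' r' h' hr' => ?_
    obtain ⟨t, ht⟩ := hmin Y' (i' ≫ i) ⟨r ≫ r', by
      rw [Category.assoc, reassoc_of% hir, h'], by rwa [← Category.assoc]⟩ ⟨i', rfl⟩
    have ht' : t ≫ i' = 𝟙 Y := by
      simpa [hir] using (ht =≫ r).symm
    have : t = r' := by
      simpa [h'] using ht' =≫ r'
    rwa [← this]
  obtain ⟨V, s, hs⟩ := exists_isSocle hfin hY
  refine ⟨Y, hY, V, s, hs, ?_⟩
  obtain ⟨t, ht⟩ := hs.exists_factor (f ≫ r) hr
  obtain ⟨t', ht'⟩ := hsimple _ t (by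
    intro h₀
    apply hs.ne_zero
    rw [ht, ← Category.assoc, h₀, zero_comp])
  obtain ⟨v, hv⟩ := exists_factor_of_kernel_le (f ≫ r) f (by
    intro V' a ha
    by_contra ha'
    obtain ⟨t, ht⟩ := hsimple V' a ha'
    apply hr
    rw [ht, Category.assoc, Category.assoc, ha, comp_zero])
  have h₁ : rank χ f ≤ rank χ (f ≫ r) := by
    conv_lhs => rw [hv]
    exact hχ.rank_comp_le_left _ _
  have h₂ : rank χ (f ≫ r) ≤ rank χ s := by
    have : f ≫ r = t' ≫ s := by
      conv_lhs => rw [ht']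
      simp only [ht, Category.assoc]
    rw [this]
    exact hχ.rank_comp_le_right _ _
  omega

/-- Otherwise `χ` is non-zero on the socle `s'` of another indecomposable `Y`. Domination by `χ_X`
gives `e : Y ⟶ X` not killing `s'`; it is monic on representables by essentiality, and split by
injectivity. Since `X` is indecomposable, `e` is an isomorphism. Then `s'` factors through `s`
followed by the inverse of `e`, so its rank is 0 as well. -/
lemma eq_zero_of_rank_socle_eq_zero [IsIdempotentComplete C] (hfin : IsLocallyFinite C)
    (hχ : IsCohomologicalFunction χ) {W X : C} (hX : Indecomposable X) {s : W ⟶ X}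
    (hs : IsSocle s) (h : ∀ {A B : C} (f : A ⟶ B),
      rank χ f ≤ imageLength (preadditiveYoneda.obj X) f) (h₀ : rank χ s = 0) : χ = 0 := by
  by_contra hne
  obtain ⟨Y, hY, V, s', hs', h'⟩ := exists_isSocle_rank_ne_zero hfin hχ hne
  obtain ⟨e, he⟩ := (imageLength_ne_zero_iff hfin (X := X) s').1 (by have := h s'; omega)
  obtain ⟨e', he'⟩ := exists_factor_of_kernel_le e (𝟙 Y) (by
    intro D a ha
    rw [hs'.eq_zero_of_comp_eq_zero e he a ha, zero_comp])
  have hee : e' ≫ e = 𝟙 X := by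
    refine (eq_zero_or_eq_id_of_idempotent hX (e' ≫ e) ?_).resolve_left fun h₁ => ?_
    · rw [Category.assoc, ← Category.assoc e, ← he', Category.id_comp]
    · apply hY.1
      rw [IsZero.iff_id_eq_zero, ← Category.comp_id (𝟙 Y), he', Category.assoc,
        reassoc_of% h₁, zero_comp, comp_zero]
  obtain ⟨t, ht⟩ := hs'.exists_factor (s ≫ e') (by
    intro h₁
    apply hs.ne_zero
    rw [← Category.comp_id s, ← hee, reassoc_of% h₁, zero_comp])
  have h₁ : rank χ s' ≤ rank χ s := by
    rw [ht]
    exact (hχ.rank_comp_le_right _ _).trans (hχ.rank_comp_le_left _ _)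
  omega

lemma chi_self_ne_zero (hfin : IsLocallyFinite C) {X : C} (hX : ¬ IsZero X) : chi X X ≠ 0 := by
  have := isNoetherian_yoneda hfin X X
  have := isArtinian_yoneda hfin X X
  intro h
  rw [chi, lengthFunction, ENat.toNat_eq_zero, or_iff_left Module.length_ne_top,
    Module.length_eq_zero_iff] at h
  exact hX ((IsZero.iff_id_eq_zero X).2 (h.elim (𝟙 X) (0 : X ⟶ X)))

lemma isIrreducibleFunction_chi [IsIdempotentComplete C] (hfin : IsLocallyFinite C)
    (hvan : ∀ X Y : C, ∃ n : ℤ, ∀ f : X ⟶ Y⟦n⟧, f = 0) {X : C} (hX : Indecomposable X) :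
    IsIrreducibleFunction (chi X) := by
  have hH := isEndofinite_yoneda hfin hvan X
  refine ⟨hH.isCohomologicalFunction, fun h => chi_self_ne_zero hfin hX.1 (congr_fun h X),
    fun χ₁ χ₂ h₁ h₂ h => ?_⟩
  obtain ⟨W, s, hs⟩ := exists_isSocle hfin hX
  have hrank : ∀ {A B : C} (f : A ⟶ B),
      imageLength (preadditiveYoneda.obj X) f = rank χ₁ f + rank χ₂ f := fun f => by
    rw [← hH.rank_eq, ← h₁.rank_add h₂ (h ▸ hH.isCohomologicalFunction), ← h]
    rfl
  have h₃ := hrank s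
  rw [hs.imageLength_eq_one] at h₃
  rcases Nat.eq_zero_or_pos (rank χ₁ s) with h₄ | h₄
  · exact Or.inl (eq_zero_of_rank_socle_eq_zero hfin h₁ hX hs
      (fun f => by rw [hrank]; omega) h₄)
  · exact Or.inr (eq_zero_of_rank_socle_eq_zero hfin h₂ hX hs
      (fun f => by rw [hrank]; omega) (by omega))

lemma exists_eq_chi [IsIdempotentComplete C] (hfin : IsLocallyFinite C)
    (hvan : ∀ X Y : C, ∃ n : ℤ, ∀ f : X ⟶ Y⟦n⟧, f = 0) (hχ : IsIrreducibleFunction χ) :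
    ∃ X : C, Indecomposable X ∧ χ = chi X := by
  obtain ⟨X, hX, W, s, hs, h⟩ := exists_isSocle_rank_ne_zero hfin hχ.cohomological hχ.ne_zero
  have hH := isEndofinite_yoneda hfin hvan X
  have hle : ∀ {A B : C} (f : A ⟶ B), rank (chi X) f ≤ rank χ f := fun f =>
    (hH.rank_eq f).le.trans (imageLength_le_rank hfin hvan hχ.cohomological hs h _ f rfl)
  -- Domination on identity morphisms makes the truncated difference exact.
  have hadd : χ = chi X + fun Y => χ Y - chi X Y := by
    funext Y
    have := hle (𝟙 Y)
    rw [hχ.cohomological.rank_id, IsCohomologicalFunction.rank_id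
      (χ := chi X) hH.isCohomologicalFunction] at this
    simp only [Pi.add_apply]
    omega
  refine ⟨X, hX, ?_⟩
  rcases hχ.irreducible _ _ hH.isCohomologicalFunction
    (hχ.cohomological.sub hH.isCohomologicalFunction hle) hadd with h₀ | h₀
  · exact absurd (congr_fun h₀ X) (chi_self_ne_zero hfin hX.1)
  · exact hadd.trans (by rw [show (fun Y => χ Y - chi X Y) = 0 from h₀, add_zero])

end Socle

end CohFun

theorem mainTheorem7 {C : Type u} [Category.{v} C] [Preadditive C] [HasZeroObject C]
    [HasShift C ℤ] [∀ n : ℤ, (shiftFunctor C n).Additive] [Pretriangulated C]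
    [IsTriangulated C] [IsIdempotentComplete C]
    (hfin : CohFun.IsLocallyFinite C)
    (hvan : ∀ X Y : C, ∃ n : ℤ, ∀ f : X ⟶ Y⟦n⟧, f = 0) :
    (∀ X : C, CohFun.IsEndofinite (preadditiveYoneda.obj X)) ∧
    CohFun.Sp C = {P | ∃ X : C, Indecomposable X ∧ P = CohFun.shiftClass (CohFun.chi X)} := by
  refine ⟨CohFun.isEndofinite_yoneda hfin hvan, Set.ext fun P => ⟨?_, ?_⟩⟩
  · rintro ⟨χ, hχ, rfl⟩
    obtain ⟨X, hX, rfl⟩ := CohFun.exists_eq_chi hfin hvan hχ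
    exact ⟨X, hX, rfl⟩
  · rintro ⟨X, hX, rfl⟩
    exact ⟨_, CohFun.isIrreducibleFunction_chi hfin hvan hX, rfl⟩
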